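/- Let $\mathbb F_q$ be a finite field with $q$ elements and let $C$ be an algebraically closed field containing $\mathbb F_q$ which is complete with respect to a non-archimedean absolute value $|\cdot|$. Write $\tau(z)=z^q$, an automorphism of $C$, so that $\tau^n(z)=z^{q^n}$ for all $n\in\mathbb Z$. Let $\mathcal F$ be the set of bi-infinite series $f=\sum_{n\in\mathbb Z}a_n\tau^n$, i.e. $f(z)=\sum_{n\in\mathbb Z}a_n z^{q^n}$, with $a_n\in C$, which converge for every $z\in C$ (for every $z$ and every $s>0$ only finitely many terms have absolute value greater than $s$). It is a ring under addition and composition, where $$\Big(\sum_i a_i\tau^i\Big)\circ\Big(\sum_j b_j\tau^j\Big)=\sum_n c_n\tau^n,\qquad c_n=\sum_{i+j=n}a_i b_j^{q^i},$$ with identity $\tau^0$. For $f\in\mathcal F$ let $\ker f=\{z\in C: f(z)=0\}$. Let $v(z)=-\log|z|$ for $z\ne0$, $v(0)=+\infty$, and $\Delta_r=\{z\in C:|z|\le r\}$. Fix a real number $r>0$ and let $\mathcal G$ be the collection of sub-$\mathbb F_q$-vector spaces $G$ of $C$ such that 1. $G\cap\Delta_r$ is compact; 2. $\int_{G\cap\Delta_r}v=+\infty$,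 the integral being with respect to a Haar measure on the compact group $G\cap\Delta_r$ (any choice of it gives the same condition); 3. $G\cap\Delta_r$ has finite or countable index in $G$, and if the index is infinite, then for every system $g_1,g_2,\dots$ of coset representatives of $G\cap\Delta_r$ in $G$ (one for each coset) $\lim_{n\to\infty}|g_n|=+\infty$. **Theorem (existence).** Every $G\in\mathcal G$ is the kernel of some $f\in\mathcal F$. This $f$ is essentially unique: if $f,g\in\mathcal F$ both have kernel $G\in\mathcal G$, then $g=\epsilon\tau^n\circ f$ for some $\epsilon\in C^*$ and $n\in\mathbb Z$; in particular $g=u\circ f$ for a unit $u$ of the ring $(\mathcal F,+,\circ)$. -/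

import Mathlib

open Filter Topology MeasureTheory

/-! `Fq` is the finite field `𝔽_q`, `C` is a field containing it, with a non-archimedean absolute
value (the multiplicative norm of a `NormedField` with `IsUltrametricDist`). -/

/-- The automorphism `τ : z ↦ z ^ q` of the algebraically closed field `C ⊇ 𝔽_q`.
Its integer powers `frob Fq C ^ n` are the maps `z ↦ z ^ (q ^ n)`, `n ∈ ℤ`; for `n < 0` this is
the unique `q ^ (-n)`-th root of `z`. -/
noncomputable def frob (Fq C : Type*) [Field Fq] [Fintype Fq] [Field C] [IsAlgClosed C]
    [Algebra Fq C] : C ≃ₐ[Fq] C :=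
  AlgEquiv.ofBijective (FiniteField.frobeniusAlgHom Fq C)
    ⟨(FiniteField.frobeniusAlgHom Fq C).toRingHom.injective,
      fun z => IsAlgClosed.exists_pow_nat_eq z Fintype.card_pos⟩

section Frob

variable {Fq C : Type*} [Field Fq] [Fintype Fq] [NormedField C] [IsAlgClosed C] [Algebra Fq C]

theorem frob_apply (z : C) : frob Fq C z = z ^ Fintype.card Fq := rfl

theorem frob_pow_apply (n : ℕ) (z : C) : (frob Fq C ^ n) z = z ^ (Fintype.card Fq ^ n) := by
  induction n generalizing z with
  | zero => simp
  | succ k ih =>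
    rw [pow_succ, AlgEquiv.mul_apply, ih, frob_apply, ← pow_mul, pow_succ']

theorem frob_zpow_add_apply (m n : ℤ) (z : C) :
    (frob Fq C ^ (m + n)) z = (frob Fq C ^ m) ((frob Fq C ^ n) z) := by
  rw [zpow_add, AlgEquiv.mul_apply]

theorem norm_frob_zpow_apply (n : ℤ) (z : C) :
    ‖(frob Fq C ^ n) z‖ = ‖z‖ ^ ((Fintype.card Fq : ℝ) ^ n) := by
  have hq : (0 : ℝ) < Fintype.card Fq := by exact_mod_cast Fintype.card_pos
  have key : ∀ (k : ℕ) (w : C), ‖(frob Fq C ^ k) w‖ = ‖w‖ ^ ((Fintype.card Fq : ℝ) ^ k) := by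
    intro k w
    rw [frob_pow_apply, norm_pow, ← Real.rpow_natCast]
    push_cast
    rfl
  obtain ⟨k, rfl | rfl⟩ := n.eq_nat_or_neg
  · simpa using key k z
  · have h : (frob Fq C ^ k) ((frob Fq C ^ (-(k : ℤ))) z) = z := by
      rw [← zpow_natCast, ← frob_zpow_add_apply]
      simp
    have h2 := key k ((frob Fq C ^ (-(k : ℤ))) z)
    rw [h] at h2
    rw [h2, ← Real.rpow_mul (norm_nonneg _), ← zpow_natCast (Fintype.card Fq : ℝ) k,
      ← zpow_add₀ hq.ne', add_neg_cancel, zpow_zero, Real.rpow_one]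

theorem norm_frob_zpow_le (n : ℤ) {z w : C} (h : ‖z‖ ≤ ‖w‖) :
    ‖(frob Fq C ^ n) z‖ ≤ ‖(frob Fq C ^ n) w‖ := by
  rw [norm_frob_zpow_apply, norm_frob_zpow_apply]
  exact Real.rpow_le_rpow (norm_nonneg _) h (zpow_nonneg (Nat.cast_nonneg _) n)

theorem tendsto_frob_zpow_zero (n : ℤ) :
    Tendsto (fun z : C => (frob Fq C ^ n) z) (𝓝 0) (𝓝 0) := by
  have hq : (0 : ℝ) < Fintype.card Fq := by exact_mod_cast Fintype.card_pos
  have he := zpow_pos hq n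
  rw [tendsto_zero_iff_norm_tendsto_zero]
  simp only [norm_frob_zpow_apply]
  have h1 : Tendsto (fun z : C => ‖z‖) (𝓝 0) (𝓝 0) := by
    simpa using (continuous_norm (E := C)).tendsto 0
  have h2 := h1.rpow_const (p := (Fintype.card Fq : ℝ) ^ n) (Or.inr he.le)
  rwa [Real.zero_rpow he.ne'] at h2

end Frob

section Ultra

variable {C : Type*} [NormedField C] {ι : Type*}

theorem exists_norm_le_of_tendsto_cofinite [Nonempty ι] {x : ι → C}
    (hx : Tendsto x cofinite (𝓝 0)) : ∃ k, ∀ j, ‖x j‖ ≤ ‖x k‖ := by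
  by_cases h : ∀ j, x j = 0
  · exact ⟨Classical.arbitrary ι, fun j => by simp [h]⟩
  push Not at h
  obtain ⟨k, hk⟩ := h
  have hfin : {j | ‖x k‖ ≤ ‖x j‖}.Finite := by
    have h1 := (tendsto_zero_iff_norm_tendsto_zero.mp hx).eventually_lt_const (norm_pos_iff.mpr hk)
    rw [eventually_cofinite] at h1
    simpa only [not_lt] using h1
  obtain ⟨m, hm, hmax⟩ := Set.exists_max_image _ (fun j => ‖x j‖) hfin ⟨k, le_refl ‖x k‖⟩
  refine ⟨m, fun j => ?_⟩
  rcases le_total ‖x k‖ ‖x j‖ with hj | hj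
  · exact hmax j hj
  · exact hj.trans hm

theorem norm_tsum_le_of_ultra [IsUltrametricDist C] {x : ι → C} {ε : ℝ} (hε : 0 ≤ ε)
    (hx : ∀ i, ‖x i‖ ≤ ε) : ‖∑' i, x i‖ ≤ ε := by
  by_cases h : Summable x
  · exact le_of_tendsto h.hasSum.norm (Eventually.of_forall fun s =>
      IsUltrametricDist.norm_sum_le_of_forall_le_of_nonneg hε fun i _ => hx i)
  · simpa [tsum_eq_zero_of_not_summable h] using hε

end Ultra

/-- The set `𝓕` of `𝔽_q`-linear fractional power series: bi-infinite series
`f = ∑_{n ∈ ℤ} a_n τ^n`, i.e. `f(z) = ∑_{n ∈ ℤ} a_n z^(q^n)`, with `a_n ∈ C`, which converge at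
every `z ∈ C`: only finitely many terms have absolute value above any given positive bound. -/
@[ext]
structure FSeries (Fq C : Type*) [Field Fq] [Fintype Fq] [NormedField C] [IsAlgClosed C]
    [Algebra Fq C] where
  coeff : ℤ → C
  converges : ∀ z : C, Tendsto (fun n : ℤ => coeff n * (frob Fq C ^ n) z) cofinite (𝓝 0)

namespace FSeries

variable {Fq C : Type*} [Field Fq] [Fintype Fq] [NormedField C] [IsAlgClosed C] [Algebra Fq C]

/-- The series `ε τ^n`. -/
noncomputable def monomial (ε : C) (n : ℤ) : FSeries Fq C where
  coeff := Pi.single n ε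
  converges z := by
    refine tendsto_nhds_of_eventually_eq ?_
    rw [eventually_cofinite]
    refine (Set.finite_singleton n).subset fun m hm => ?_
    by_contra h
    exact hm (by rw [Pi.single_eq_of_ne h, zero_mul])

/-- The series `1 = τ^0`, i.e. `z`, the identity for composition. -/
noncomputable def one : FSeries Fq C := monomial 1 0

theorem summable [IsUltrametricDist C] [CompleteSpace C] (f : FSeries Fq C) (z : C) :
    Summable fun n : ℤ => f.coeff n * (frob Fq C ^ n) z :=
  NonarchimedeanAddGroup.summable_of_tendsto_cofinite_zero (f.converges z)

/-- The `𝔽_q`-linear map `C → C`, `z ↦ ∑_{n ∈ ℤ} a_n z^(q^n)`, defined by `f`. -/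
noncomputable def toLinearMap [IsUltrametricDist C] [CompleteSpace C] (f : FSeries Fq C) :
    C →ₗ[Fq] C where
  toFun z := ∑' n : ℤ, f.coeff n * (frob Fq C ^ n) z
  map_add' x y := by
    rw [← (f.summable x).tsum_add (f.summable y)]
    simp only [map_add, mul_add]
  map_smul' c x := by
    rw [RingHom.id_apply, Algebra.smul_def c (∑' n : ℤ, f.coeff n * (frob Fq C ^ n) x),
      ← tsum_mul_left]
    simp only [Algebra.smul_def, map_mul, AlgEquiv.commutes, mul_left_comm]

/-- The kernel `{z ∈ C : f(z) = 0}` of `f`. -/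
noncomputable def ker [IsUltrametricDist C] [CompleteSpace C] (f : FSeries Fq C) :
    Submodule Fq C :=
  LinearMap.ker f.toLinearMap

theorem tendsto_comp_terms (f g : FSeries Fq C) (z : C) :
    Tendsto (fun p : ℤ × ℤ => f.coeff p.1 * (frob Fq C ^ p.1) (g.coeff p.2 * (frob Fq C ^ p.2) z))
      cofinite (𝓝 0) := by
  obtain ⟨k, hk⟩ := exists_norm_le_of_tendsto_cofinite (g.converges z)
  set x : ℤ → C := fun n => g.coeff n * (frob Fq C ^ n) z with hx
  rw [Metric.tendsto_nhds]
  intro ε hε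
  simp only [dist_zero_right]
  rw [eventually_cofinite]
  have hI := (Metric.tendsto_nhds.mp (f.converges (x k))) ε hε
  simp only [dist_zero_right] at hI
  rw [eventually_cofinite] at hI
  have hJ : ∀ i : ℤ, {j : ℤ | ¬ ‖f.coeff i * (frob Fq C ^ i) (x j)‖ < ε}.Finite := by
    intro i
    have h1 : Tendsto (fun j => f.coeff i * (frob Fq C ^ i) (x j)) cofinite (𝓝 0) := by
      have h2 := ((tendsto_frob_zpow_zero (Fq := Fq) (C := C) i).comp
        (g.converges z)).const_mul (f.coeff i)
      rw [mul_zero] at h2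
      exact h2
    have h3 := (Metric.tendsto_nhds.mp h1) ε hε
    simp only [dist_zero_right] at h3
    rwa [eventually_cofinite] at h3
  refine ((hI.biUnion fun i _ => (hJ i).image (Prod.mk i))).subset ?_
  rintro ⟨i, j⟩ hij
  have hij' : ε ≤ ‖f.coeff i * (frob Fq C ^ i) (x j)‖ := not_lt.mp hij
  simp only [Set.mem_iUnion]
  refine ⟨i, ?_, j, hij, rfl⟩
  simp only [Set.mem_ofPred_eq, not_lt]
  refine hij'.trans ?_
  rw [norm_mul, norm_mul]
  exact mul_le_mul_of_nonneg_left (norm_frob_zpow_le i (hk j)) (norm_nonneg _)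

/-- The composition `f ∘ g`, the multiplication of the ring `𝓕`: if `f = ∑ a_i τ^i` and
`g = ∑ b_j τ^j`, the coefficient of `τ^n` in `f ∘ g` is `∑_{i+j=n} a_i b_j^(q^i)`. -/
noncomputable def comp [IsUltrametricDist C] (f g : FSeries Fq C) : FSeries Fq C where
  coeff n := ∑' i : ℤ, f.coeff i * (frob Fq C ^ i) (g.coeff (n - i))
  converges z := by
    rw [Metric.tendsto_nhds]
    intro ε hε
    have h := (Metric.tendsto_nhds.mp (tendsto_comp_terms f g z)) (ε / 2) (half_pos hε)
    simp only [dist_zero_right] at h ⊢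
    rw [eventually_cofinite] at h ⊢
    refine (h.image fun p => p.1 + p.2).subset fun n hn => ?_
    by_contra hcon
    apply hn
    rw [← tsum_mul_right]
    refine lt_of_le_of_lt (norm_tsum_le_of_ultra (half_pos hε).le fun i => ?_) (half_lt_self hε)
    by_contra hi
    refine hcon ⟨(i, n - i), ?_, by simp⟩
    simp only [Set.mem_ofPred_eq, not_lt]
    refine (not_le.mp hi).le.trans (le_of_eq ?_)
    rw [map_mul, ← frob_zpow_add_apply, add_sub_cancel, mul_assoc]

/-- `u` is a unit of the ring `(𝓕, +, ∘)`. -/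
def IsUnit [IsUltrametricDist C] (u : FSeries Fq C) : Prop :=
  ∃ w : FSeries Fq C, u.comp w = one ∧ w.comp u = one

end FSeries

/-- The valuation `v(z) = -log |z|`, with `v(0) = +∞`. -/
noncomputable def addVal {C : Type*} [NormedField C] (z : C) : EReal :=
  open scoped Classical in if z = 0 then ⊤ else ((-Real.log ‖z‖ : ℝ) : EReal)

/-- The integral of an extended-real-valued function: the integral of the positive part minus the
integral of the negative part. (In `EReal` one has `⊤ - ⊤ = ⊥`, so the value `⊤` means that the
positive part has infinite integral and the negative part has finite integral.) -/
noncomputable def erealIntegral {X : Type*} [MeasurableSpace X] (μ : Measure X)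
    (φ : X → EReal) : EReal :=
  ((∫⁻ x, (φ x).toENNReal ∂μ : ENNReal) : EReal) - ((∫⁻ x, (-φ x).toENNReal ∂μ : ENNReal) : EReal)

section ClassG

variable {Fq C : Type*} [Field Fq] [NormedField C] [IsUltrametricDist C] [Algebra Fq C]

/-- The subgroup `G ∩ Δ_r` of `C`, where `Δ_r = {z : |z| ≤ r}`. -/
def diskPart (G : Submodule Fq C) (r : ℝ) (hr : 0 < r) : AddSubgroup C :=
  G.toAddSubgroup ⊓ (IsUltrametricDist.closedBall_openAddSubgroup C hr).toAddSubgroup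

theorem mem_diskPart {G : Submodule Fq C} {r : ℝ} {hr : 0 < r} {z : C} :
    z ∈ diskPart G r hr ↔ z ∈ G ∧ ‖z‖ ≤ r := by
  rw [← mem_closedBall_zero_iff]
  rfl

/-- `∫_H v = +∞` with respect to Haar measure on the group `H`. As Haar measures on `H` differ by
positive finite factors, it does not matter which one is taken. -/
def IntegralAddValEqTop (H : AddSubgroup C) : Prop :=
  letI : MeasurableSpace H := borel H
  ∃ μ : Measure H, μ.IsAddHaarMeasure ∧ erealIntegral μ (fun z : H => addVal (z : C)) = ⊤

/-- The class `𝓖` of sub-`𝔽_q`-vector spaces `G` of `C`, defined by means of the radius `r > 0`. -/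
structure IsClassG (r : ℝ) (hr : 0 < r) (G : Submodule Fq C) : Prop where
  /-- `G ∩ Δ_r` is compact. -/
  isCompact : IsCompact (diskPart G r hr : Set C)
  /-- `∫_{G ∩ Δ_r} v = +∞`. -/
  integral : IntegralAddValEqTop (diskPart G r hr)
  /-- `G ∩ Δ_r` has finite or countable index in `G`. -/
  countable_index : Countable (G.toAddSubgroup ⧸ (diskPart G r hr).addSubgroupOf G.toAddSubgroup)
  /-- If the index is infinite, any sequence of representatives of the cosets, one for each coset,
  tends to infinity in absolute value. -/
  tendsto_coset_rep : ∀ g : ℕ → G.toAddSubgroup,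
    Function.Bijective (fun n => (QuotientAddGroup.mk (g n) :
      G.toAddSubgroup ⧸ (diskPart G r hr).addSubgroupOf G.toAddSubgroup)) →
    Tendsto (fun n => ‖(g n : C)‖) atTop atTop

end ClassG

/-!
Existence. Composing `f` with `1 - b τ⁻¹` or `1 - b τ` on the left enlarges the kernel by one
`𝔽_q`-dimension, and the kernel `G` is built up in this way, first inside the disk `Δ_r`, then
outside.

For the compact part `H = G ∩ Δ_r`, take a dense sequence `w` in `H` and let
`f_{i+1} = (1 - b_i τ⁻¹) ∘ f_i` with `b_i^q = f_i(w_i)^(q-1)`. Then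
`|f_{i+1}(z)|^q = ∏_c |f_i(z - c w_i)|`, so `log |f_i(z)|` is the average of `log |z - w|` over the
`𝔽_q`-linear combinations `w` of `w_0, …, w_{i-1}`. Truncate the logarithm below at `log ρ`: the
average no longer sees the elements of `H` of size at most `ρ`, so for large `i` it is constant on
`H`, and by invariance of Haar measure the constant is the mean over `H` of `log max(|z|, ρ)`
(`integral_avgLog`). These means tend to `-∞` as `ρ → 0` exactly because `∫_H v = +∞`. Hence
`b_i → 0`, the `f_i` converge, and the kernel of the limit is `H`, since `|f_i(z)|` is at least the
distance from `z` to `H`.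

For the discrete part, adjoin coset representatives `x_i` of `H` in `G` by
`g_{i+1} = (1 - g_i(x_i)^(1-q) τ) ∘ g_i`. The series `g_i` maps the disk of radius `ρ` onto the disk
of radius `|g_i|_ρ = sup_n |a_n| ρ^(q^n)` (`FSeries.exists_toLinearMap_eq`); as only finitely many
cosets of `H` meet that disk, `|g_i(x_i)| > |g_i|_ρ` for all but finitely many `i` with
`g_i(x_i) ≠ 0` (`FSeries.eventually_gaussNorm_lt_norm_outerSeries`). So the `g_i` converge.

Uniqueness. Let `N_f(R)` be the largest index at which the supremum `|f|_R` is attained. If `N_f`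
jumps between two radii, `f` has a zero in between, and dividing `f` on the right by `1 - b τ⁻¹`
removes that zero and the jump. Therefore `N_h` grows at least as fast as `N_f` when
`ker f ⊆ ker h` (`FSeries.isTop_sub_le`). For `f` and `g` with the same kernel, `N_f - N_g` is
constant; after replacing `g` by a suitable `ε τ^n ∘ g` one may assume that `N_f = N_g` and that the
coefficients of `f` and `g` at `N_f(1)` agree. As `q^N_f` is the slope of `log |f|_R` in `log R`,
then `|f|_R = |g|_R` for all `R`. If `h = f - g` were nonzero, `N_h - N_f` would be nondecreasing
and nonzero at `R = 1`, which contradicts `|h|_R ≤ |f|_R` as `R → ∞` or as `R → 0`.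
-/

/-! ### Gauss norms and top indices -/

section Card

variable (Fq : Type*) [Field Fq] [Fintype Fq]

theorem one_lt_card_real : (1 : ℝ) < Fintype.card Fq := by
  exact_mod_cast Fintype.one_lt_card

theorem card_zpow_pos (n : ℤ) : (0 : ℝ) < (Fintype.card Fq : ℝ) ^ n :=
  zpow_pos (zero_lt_one.trans (one_lt_card_real Fq)) n

theorem card_zpow_le {m n : ℤ} (h : m ≤ n) :
    (Fintype.card Fq : ℝ) ^ m ≤ (Fintype.card Fq : ℝ) ^ n :=
  zpow_le_zpow_right₀ (one_lt_card_real Fq).le h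

end Card

namespace FSeries

variable {Fq C : Type*} [Field Fq] [Fintype Fq] [NormedField C] [IsAlgClosed C] [Algebra Fq C]

instance : Zero (FSeries Fq C) := ⟨⟨0, fun z => by simp⟩⟩

instance : Sub (FSeries Fq C) where
  sub f g :=
    { coeff := fun n => f.coeff n - g.coeff n
      converges := fun z => by
        simpa [sub_mul] using (f.converges z).sub (g.converges z) }

@[simp] theorem coeff_zero (n : ℤ) : (0 : FSeries Fq C).coeff n = 0 := rfl

@[simp] theorem coeff_sub (f g : FSeries Fq C) (n : ℤ) :
    (f - g).coeff n = f.coeff n - g.coeff n := rfl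

theorem exists_coeff_ne_zero {f : FSeries Fq C} (hf : f ≠ 0) : ∃ n, f.coeff n ≠ 0 := by
  by_contra! h
  exact hf (FSeries.ext (funext h))

/-- The absolute value `|a_n| R^(q^n)` of the `n`-th term of `f` at points with `|z| = R`; the
real number `R` need not be the absolute value of an element of `C`. -/
noncomputable def termNorm (f : FSeries Fq C) (R : ℝ) (n : ℤ) : ℝ :=
  ‖f.coeff n‖ * R ^ ((Fintype.card Fq : ℝ) ^ n)

/-- The Gauss norm `|f|_R = sup_n |a_n| R^(q^n)`. -/
noncomputable def gaussNorm (f : FSeries Fq C) (R : ℝ) : ℝ := ⨆ n, f.termNorm R n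

/-- `n` is the largest index at which the supremum `|f|_R` is attained. -/
structure IsTop (f : FSeries Fq C) (R : ℝ) (n : ℤ) : Prop where
  le : ∀ m, f.termNorm R m ≤ f.termNorm R n
  lt : ∀ m, n < m → f.termNorm R m < f.termNorm R n

theorem norm_term (f : FSeries Fq C) (n : ℤ) (z : C) :
    ‖f.coeff n * (frob Fq C ^ n) z‖ = f.termNorm ‖z‖ n := by
  rw [norm_mul, norm_frob_zpow_apply, termNorm]

theorem termNorm_nonneg (f : FSeries Fq C) {R : ℝ} (hR : 0 ≤ R) (n : ℤ) : 0 ≤ f.termNorm R n := by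
  unfold termNorm; positivity

theorem termNorm_mono (f : FSeries Fq C) {R S : ℝ} (hR : 0 ≤ R) (h : R ≤ S) (n : ℤ) :
    f.termNorm R n ≤ f.termNorm S n :=
  mul_le_mul_of_nonneg_left (Real.rpow_le_rpow hR h (card_zpow_pos Fq n).le) (norm_nonneg _)

theorem termNorm_lt_of_ne_zero (f : FSeries Fq C) {R S : ℝ} (hR : 0 ≤ R) (h : R < S) {n : ℤ}
    (hn : f.coeff n ≠ 0) : f.termNorm R n < f.termNorm S n :=
  mul_lt_mul_of_pos_left (Real.rpow_lt_rpow hR h (card_zpow_pos Fq n)) (norm_pos_iff.mpr hn)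

theorem termNorm_pos (f : FSeries Fq C) {R : ℝ} (hR : 0 < R) {n : ℤ} (hn : f.coeff n ≠ 0) :
    0 < f.termNorm R n :=
  mul_pos (norm_pos_iff.mpr hn) (Real.rpow_pos_of_pos hR _)

theorem termNorm_sub_le [IsUltrametricDist C] (f g : FSeries Fq C) {R : ℝ} (hR : 0 ≤ R) (n : ℤ) :
    (f - g).termNorm R n ≤ max (f.termNorm R n) (g.termNorm R n) := by
  unfold termNorm
  rw [← max_mul_of_nonneg _ _ (by positivity)]
  refine mul_le_mul_of_nonneg_right ?_ (by positivity)
  simpa [sub_eq_add_neg] using IsUltrametricDist.norm_add_le_max (f.coeff n) (-g.coeff n)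

/-- If every element of `C` has absolute value at most `1`, convergence at `z = 1` leaves only
finitely many nonzero coefficients, so the terms tend to zero at every real radius. -/
theorem tendsto_termNorm (f : FSeries Fq C) {R : ℝ} (hR : 0 ≤ R) :
    Tendsto (f.termNorm R) cofinite (𝓝 0) := by
  by_cases h : ∃ c : C, 1 < ‖c‖
  · obtain ⟨c, hc⟩ := h
    obtain ⟨k, hk⟩ := pow_unbounded_of_one_lt R hc
    have h1 := (f.converges (c ^ k)).norm
    simp only [norm_term, norm_pow, norm_zero] at h1
    exact squeeze_zero (fun n => f.termNorm_nonneg hR n) (fun n => f.termNorm_mono hR hk.le n) h1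
  · push Not at h
    have h1 : ∀ c : C, c ≠ 0 → ‖c‖ = 1 := by
      intro c hc
      refine le_antisymm (h c) ?_
      have := h c⁻¹
      rw [norm_inv] at this
      exact (inv_le_one₀ (norm_pos_iff.mpr hc)).mp this
    have h2 := (f.converges 1).norm
    simp only [map_one, mul_one, norm_zero] at h2
    refine tendsto_nhds_of_eventually_eq ?_
    filter_upwards [h2.eventually_lt_const one_pos] with n hn
    have : f.coeff n = 0 := by
      by_contra hc
      exact hn.ne (h1 _ hc)
    simp [termNorm, this]

theorem bddAbove_termNorm (f : FSeries Fq C) {R : ℝ} (hR : 0 ≤ R) :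
    BddAbove (Set.range (f.termNorm R)) := by
  have h1 := (f.tendsto_termNorm hR).eventually_lt_const one_pos
  rw [eventually_cofinite] at h1
  obtain ⟨B, hB⟩ := (h1.image (f.termNorm R)).bddAbove
  refine ⟨max B 1, ?_⟩
  rintro _ ⟨n, rfl⟩
  by_cases hn : f.termNorm R n < 1
  · exact hn.le.trans (le_max_right _ _)
  · exact (hB ⟨n, hn, rfl⟩).trans (le_max_left _ _)

theorem termNorm_le_gaussNorm (f : FSeries Fq C) {R : ℝ} (hR : 0 ≤ R) (n : ℤ) :
    f.termNorm R n ≤ f.gaussNorm R :=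
  le_ciSup (f.bddAbove_termNorm hR) n

theorem gaussNorm_le {f : FSeries Fq C} {R B : ℝ} (h : ∀ n, f.termNorm R n ≤ B) :
    f.gaussNorm R ≤ B :=
  ciSup_le h

theorem gaussNorm_nonneg (f : FSeries Fq C) {R : ℝ} (hR : 0 ≤ R) : 0 ≤ f.gaussNorm R :=
  (f.termNorm_nonneg hR 0).trans (f.termNorm_le_gaussNorm hR 0)

theorem gaussNorm_mono (f : FSeries Fq C) {R S : ℝ} (hR : 0 ≤ R) (h : R ≤ S) :
    f.gaussNorm R ≤ f.gaussNorm S :=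
  gaussNorm_le fun n => (f.termNorm_mono hR h n).trans (f.termNorm_le_gaussNorm (hR.trans h) n)

theorem gaussNorm_pos {f : FSeries Fq C} (hf : f ≠ 0) {R : ℝ} (hR : 0 < R) :
    0 < f.gaussNorm R := by
  obtain ⟨n, hn⟩ := exists_coeff_ne_zero hf
  exact (f.termNorm_pos hR hn).trans_le (f.termNorm_le_gaussNorm hR.le n)

theorem gaussNorm_sub_le [IsUltrametricDist C] (f g : FSeries Fq C) {R : ℝ} (hR : 0 ≤ R) :
    (f - g).gaussNorm R ≤ max (f.gaussNorm R) (g.gaussNorm R) :=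
  gaussNorm_le fun n => (termNorm_sub_le f g hR n).trans
    (max_le_max (f.termNorm_le_gaussNorm hR n) (g.termNorm_le_gaussNorm hR n))

theorem gaussNorm_sub_comm (f g : FSeries Fq C) (R : ℝ) :
    (f - g).gaussNorm R = (g - f).gaussNorm R := by
  simp only [gaussNorm, termNorm, coeff_sub, norm_sub_rev]

theorem IsTop.gaussNorm_eq {f : FSeries Fq C} {R : ℝ} {n : ℤ} (h : f.IsTop R n) (hR : 0 ≤ R) :
    f.gaussNorm R = f.termNorm R n :=
  le_antisymm (gaussNorm_le h.le) (f.termNorm_le_gaussNorm hR n)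

theorem IsTop.coeff_ne_zero {f : FSeries Fq C} {R : ℝ} {n : ℤ} (h : f.IsTop R n) (hR : 0 ≤ R) :
    f.coeff n ≠ 0 := by
  intro h0
  have h1 := h.lt (n + 1) (lt_add_one n)
  have h2 := f.termNorm_nonneg hR (n + 1)
  simp only [termNorm, h0, norm_zero, zero_mul] at h1 h2
  linarith

theorem IsTop.ne_zero {f : FSeries Fq C} {R : ℝ} {n : ℤ} (h : f.IsTop R n) (hR : 0 ≤ R) :
    f ≠ 0 := by
  rintro rfl
  exact h.coeff_ne_zero hR rfl

theorem IsTop.unique {f : FSeries Fq C} {R : ℝ} {m n : ℤ} (hm : f.IsTop R m) (hn : f.IsTop R n) :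
    m = n := by
  rcases lt_trichotomy m n with h | h | h
  · exact absurd (hn.le m) (by have := hm.lt n h; have := hn.le m; linarith [hm.le n])
  · exact h
  · exact absurd (hm.le n) (by have := hn.lt m h; linarith [hn.le m])

theorem exists_isTop {f : FSeries Fq C} (hf : f ≠ 0) {R : ℝ} (hR : 0 < R) : ∃ n, f.IsTop R n := by
  obtain ⟨k, hk⟩ := exists_coeff_ne_zero hf
  have hpos := f.termNorm_pos hR hk
  have hfin : {j | f.termNorm R k ≤ f.termNorm R j}.Finite := by
    have h1 := (f.tendsto_termNorm hR.le).eventually_lt_const hpos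
    rw [eventually_cofinite] at h1
    simpa only [not_lt] using h1
  obtain ⟨m, hm, hmax⟩ := Set.exists_max_image _ (f.termNorm R) hfin ⟨k, le_refl (f.termNorm R k)⟩
  have hm' : ∀ j, f.termNorm R j ≤ f.termNorm R m := by
    intro j
    rcases le_total (f.termNorm R k) (f.termNorm R j) with hj | hj
    · exact hmax j hj
    · exact hj.trans hm
  have hfin2 : {j | f.termNorm R m ≤ f.termNorm R j}.Finite :=
    hfin.subset fun j (hj : f.termNorm R m ≤ f.termNorm R j) =>
      show f.termNorm R k ≤ f.termNorm R j from le_trans hm hj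
  obtain ⟨n, hn, hnmax⟩ := Set.exists_max_image _ id hfin2 ⟨m, le_refl (f.termNorm R m)⟩
  refine ⟨n, fun j => (hm' j).trans hn, fun j hj => ?_⟩
  by_contra! h
  exact absurd (hnmax j (le_trans hn h)) (not_le.mpr hj)

theorem IsTop.mono {f : FSeries Fq C} {R S : ℝ} (hR : 0 < R) (hRS : R ≤ S) {m n : ℤ}
    (hm : f.IsTop R m) (hn : f.IsTop S n) : m ≤ n := by
  by_contra! h
  have h1 := hn.lt m h
  have h2 := hm.le n
  have hS := hR.trans_le hRS
  -- pass from radius `R` to radius `S`: the term with the larger index grows at least as fast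
  have key : ∀ k, f.termNorm S k = f.termNorm R k * (S / R) ^ ((Fintype.card Fq : ℝ) ^ k) := by
    intro k
    rw [termNorm, termNorm, mul_assoc, ← Real.mul_rpow hR.le (by positivity),
      mul_div_cancel₀ _ hR.ne']
  rw [key, key] at h1
  have h3 : (S / R) ^ ((Fintype.card Fq : ℝ) ^ n) ≤ (S / R) ^ ((Fintype.card Fq : ℝ) ^ m) :=
    Real.rpow_le_rpow_of_exponent_le ((one_le_div hR).mpr hRS) (card_zpow_le Fq h.le)
  have h4 := mul_le_mul h2 h3 (by positivity) (f.termNorm_nonneg hR.le m)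
  linarith

theorem exists_forall_gaussNorm_le (f : FSeries Fq C) {ε : ℝ} (hε : 0 < ε) :
    ∃ δ > 0, ∀ R, 0 ≤ R → R ≤ δ → f.gaussNorm R ≤ ε := by
  have h1 := (f.tendsto_termNorm zero_le_one).eventually_lt_const hε
  rw [eventually_cofinite] at h1
  have h2 : ∀ᶠ R : ℝ in 𝓝 0, ∀ n ∈ {n | ¬ f.termNorm 1 n < ε}, f.termNorm R n < ε := by
    rw [eventually_all_finite h1]
    intro n _
    have h3 : Tendsto (fun R : ℝ => f.termNorm R n) (𝓝 0) (𝓝 0) := by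
      have h4 := ((tendsto_id (α := ℝ) (x := 𝓝 0)).rpow_const
        (p := (Fintype.card Fq : ℝ) ^ n) (Or.inr (card_zpow_pos Fq n).le)).const_mul ‖f.coeff n‖
      rwa [Real.zero_rpow (card_zpow_pos Fq n).ne', mul_zero] at h4
    exact h3.eventually_lt_const hε
  obtain ⟨δ, hδ, hball⟩ := Metric.eventually_nhds_iff.mp h2
  refine ⟨min 1 (δ / 2), by positivity, fun R hR0 hR => gaussNorm_le fun n => ?_⟩
  by_cases hn : f.termNorm 1 n < ε
  · exact (f.termNorm_mono hR0 (hR.trans (min_le_left _ _)) n).trans hn.le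
  · refine (hball ?_ n hn).le
    rw [Real.dist_eq, sub_zero, abs_of_nonneg hR0]
    linarith [min_le_right (1 : ℝ) (δ / 2)]

section Eval

variable [IsUltrametricDist C] [CompleteSpace C]

theorem toLinearMap_apply (f : FSeries Fq C) (z : C) :
    f.toLinearMap z = ∑' n : ℤ, f.coeff n * (frob Fq C ^ n) z := rfl

theorem mem_ker {f : FSeries Fq C} {z : C} : z ∈ f.ker ↔ f.toLinearMap z = 0 := Iff.rfl

theorem toLinearMap_sub (f g : FSeries Fq C) (z : C) :
    (f - g).toLinearMap z = f.toLinearMap z - g.toLinearMap z := by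
  simp only [toLinearMap_apply, coeff_sub, sub_mul]
  exact (f.summable z).tsum_sub (g.summable z)

theorem norm_toLinearMap_le (f : FSeries Fq C) {z : C} {R : ℝ} (h : ‖z‖ ≤ R) :
    ‖f.toLinearMap z‖ ≤ f.gaussNorm R := by
  have hR := (norm_nonneg z).trans h
  refine norm_tsum_le_of_ultra (f.gaussNorm_nonneg hR) fun n => ?_
  rw [norm_term]
  exact (f.termNorm_mono (norm_nonneg z) h n).trans (f.termNorm_le_gaussNorm hR n)

theorem continuous_toLinearMap (f : FSeries Fq C) : Continuous f.toLinearMap := by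
  refine continuous_of_continuousAt_zero f.toLinearMap.toAddMonoidHom ?_
  rw [Metric.continuousAt_iff]
  intro ε hε
  obtain ⟨δ, hδ, h⟩ := f.exists_forall_gaussNorm_le (half_pos hε)
  refine ⟨δ, hδ, fun z hz => ?_⟩
  rw [map_zero, dist_zero_right] at *
  exact ((f.norm_toLinearMap_le le_rfl).trans (h _ (norm_nonneg z) hz.le)).trans_lt
    (half_lt_self hε)

end Eval

theorem exists_of_tendsto_termNorm (a : ℤ → C)
    (h : ∀ R : ℝ, 0 < R →
      Tendsto (fun n : ℤ => ‖a n‖ * R ^ ((Fintype.card Fq : ℝ) ^ n)) cofinite (𝓝 0)) :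
    ∃ f : FSeries Fq C, f.coeff = a := by
  refine ⟨⟨a, fun z => ?_⟩, rfl⟩
  rcases eq_or_ne z 0 with rfl | hz
  · simp
  · rw [tendsto_zero_iff_norm_tendsto_zero]
    simpa only [norm_mul, norm_frob_zpow_apply] using h ‖z‖ (norm_pos_iff.mpr hz)

/-- `𝓕` is complete for the family of Gauss norms. -/
theorem exists_limit [IsUltrametricDist C] [CompleteSpace C] (f : ℕ → FSeries Fq C)
    (h : ∀ R : ℝ, 0 < R → Tendsto (fun i => (f (i + 1) - f i).gaussNorm R) atTop (𝓝 0)) :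
    ∃ g : FSeries Fq C, ∀ R : ℝ, 0 < R →
      Tendsto (fun i => (g - f i).gaussNorm R) atTop (𝓝 0) := by
  have hc : ∀ n, CauchySeq fun i => (f i).coeff n := by
    intro n
    refine NonarchimedeanAddGroup.cauchySeq_of_tendsto_sub_nhds_zero ?_
    rw [tendsto_zero_iff_norm_tendsto_zero]
    refine squeeze_zero (fun _ => norm_nonneg _) (fun i => ?_) (h 1 one_pos)
    have := (f (i + 1) - f i).termNorm_le_gaussNorm zero_le_one n
    simpa [termNorm] using this
  choose a ha using fun n => cauchySeq_tendsto_of_complete (hc n)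
  -- by the ultrametric inequality, a bound for all later steps bounds the distance to the limit
  have hstep : ∀ R : ℝ, 0 < R → ∀ ε : ℝ, 0 < ε → ∃ N, ∀ i ≥ N, ∀ n,
      ‖a n - (f i).coeff n‖ * R ^ ((Fintype.card Fq : ℝ) ^ n) ≤ ε := by
    intro R hR ε hε
    obtain ⟨N, hN⟩ := eventually_atTop.mp ((h R hR).eventually_le_const hε)
    refine ⟨N, fun i hi n => ?_⟩
    have hj : ∀ j ≥ i, ‖(f j).coeff n - (f i).coeff n‖ * R ^ ((Fintype.card Fq : ℝ) ^ n) ≤ ε := by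
      intro j hj
      induction j, hj using Nat.le_induction with
      | base => simpa using hε.le
      | succ j hj ih =>
        have h1 := ((f (j + 1) - f j).termNorm_le_gaussNorm hR.le n).trans (hN j (hi.trans hj))
        have h2 : ‖(f (j + 1)).coeff n - (f i).coeff n‖ ≤
            max ‖(f (j + 1)).coeff n - (f j).coeff n‖ ‖(f j).coeff n - (f i).coeff n‖ := by
          rw [← sub_add_sub_cancel _ ((f j).coeff n)]
          exact IsUltrametricDist.norm_add_le_max _ _
        have hp : 0 ≤ R ^ ((Fintype.card Fq : ℝ) ^ n) := by positivity
        refine (mul_le_mul_of_nonneg_right h2 hp).trans ?_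
        rw [max_mul_of_nonneg _ _ hp]
        exact max_le h1 ih
    refine le_of_tendsto (((ha n).sub_const _).norm.mul_const _) ?_
    filter_upwards [eventually_ge_atTop i] with j hji using hj j hji
  obtain ⟨g, hg⟩ := exists_of_tendsto_termNorm (Fq := Fq) a (by
    intro R hR
    rw [Metric.tendsto_nhds]
    intro ε hε
    obtain ⟨N, hN⟩ := hstep R hR (ε / 2) (half_pos hε)
    filter_upwards [((f N).tendsto_termNorm hR.le).eventually_lt_const (half_pos hε)] with n hn
    have h1 := hN N le_rfl n
    have h2 : ‖a n‖ ≤ max ‖a n - (f N).coeff n‖ ‖(f N).coeff n‖ := by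
      simpa using IsUltrametricDist.norm_add_le_max (a n - (f N).coeff n) ((f N).coeff n)
    have hp : 0 ≤ R ^ ((Fintype.card Fq : ℝ) ^ n) := by positivity
    rw [Real.dist_eq, sub_zero, abs_of_nonneg (by positivity)]
    refine (mul_le_mul_of_nonneg_right h2 hp).trans_lt ?_
    rw [max_mul_of_nonneg _ _ hp]
    exact max_lt (h1.trans_lt (half_lt_self hε)) (hn.trans (half_lt_self hε)))
  refine ⟨g, fun R hR => ?_⟩
  rw [Metric.tendsto_atTop]
  intro ε hε
  obtain ⟨N, hN⟩ := hstep R hR (ε / 2) (half_pos hε)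
  refine ⟨N, fun i hi => ?_⟩
  rw [Real.dist_eq, sub_zero, abs_of_nonneg (gaussNorm_nonneg _ hR.le)]
  refine (gaussNorm_le fun n => ?_).trans_lt (half_lt_self hε)
  have := hN i hi n
  rwa [← hg] at this

theorem tendsto_toLinearMap_of_gaussNorm [IsUltrametricDist C] [CompleteSpace C]
    {f : ℕ → FSeries Fq C} {g : FSeries Fq C}
    (h : ∀ R : ℝ, 0 < R → Tendsto (fun i => (g - f i).gaussNorm R) atTop (𝓝 0)) (z : C) :
    Tendsto (fun i => (f i).toLinearMap z) atTop (𝓝 (g.toLinearMap z)) := by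
  rw [tendsto_iff_norm_sub_tendsto_zero]
  refine squeeze_zero (fun _ => norm_nonneg _) (fun i => ?_)
    (h (‖z‖ + 1) (by positivity))
  rw [norm_sub_rev, ← toLinearMap_sub]
  exact norm_toLinearMap_le _ (by linarith)

end FSeries

/-! ### Zeros of polynomials and of series -/

section Poly

open Polynomial

variable {C : Type*} [NormedField C]

/-- For a product of linear factors, the largest index at which the Gauss norm of radius `R` is
attained is the number of roots in the disk of radius `R`. -/
theorem norm_coeff_multiset_prod_le [IsUltrametricDist C] (s : Multiset C) {R : ℝ} (hR : 0 < R) :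
    ∃ k : ℕ, k = Multiset.countP (fun a => ‖a‖ ≤ R) s ∧
      (∀ m, ‖(s.map fun a => X - Polynomial.C a).prod.coeff m‖ * R ^ m ≤
        ‖(s.map fun a => X - Polynomial.C a).prod.coeff k‖ * R ^ k) ∧
      ∀ m, k < m → ‖(s.map fun a => X - Polynomial.C a).prod.coeff m‖ * R ^ m <
        ‖(s.map fun a => X - Polynomial.C a).prod.coeff k‖ * R ^ k := by
  induction s using Multiset.induction with
  | empty =>
    refine ⟨0, by simp, fun m => ?_, fun m hm => ?_⟩
    · rcases eq_or_ne m 0 with rfl | hm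
      · simp
      · simp [coeff_one, hm]
    · simp [coeff_one, hm.ne']
  | cons a s ih =>
    obtain ⟨k, hk, hle, hlt⟩ := ih
    set p := (s.map fun a => X - Polynomial.C a).prod with hp
    have hcoef : ∀ m, ((X - Polynomial.C a) * p).coeff (m + 1) =
        p.coeff m - a * p.coeff (m + 1) := by
      intro m
      rw [sub_mul, coeff_sub, coeff_X_mul, coeff_C_mul]
    have hcoef0 : ((X - Polynomial.C a) * p).coeff 0 = - (a * p.coeff 0) := by
      rw [sub_mul, coeff_sub, coeff_X_mul_zero, coeff_C_mul, zero_sub]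
    simp only [Multiset.map_cons, Multiset.prod_cons, ← hp]
    set T := ‖p.coeff k‖ * R ^ k with hT
    have hT0 : 0 < T := (by positivity : 0 ≤ ‖p.coeff (k + 1)‖ * R ^ (k + 1)).trans_lt
      (hlt (k + 1) k.lt_succ_self)
    have hsub : ∀ x y : C, ‖x - y‖ ≤ max ‖x‖ ‖y‖ := fun x y => by
      simpa [sub_eq_add_neg] using IsUltrametricDist.norm_add_le_max x (-y)
    have hpm : ∀ m, ‖p.coeff m‖ * R ^ (m + 1) = R * (‖p.coeff m‖ * R ^ m) := fun m => by ring
    have ham : ∀ m, ‖a * p.coeff m‖ * R ^ m = ‖a‖ * (‖p.coeff m‖ * R ^ m) := fun m => by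
      rw [norm_mul]; ring
    by_cases ha : ‖a‖ ≤ R
    · have htop : ‖((X - Polynomial.C a) * p).coeff (k + 1)‖ * R ^ (k + 1) = R * T := by
        have h2 : ‖a * p.coeff (k + 1)‖ < ‖p.coeff k‖ := by
          refine lt_of_mul_lt_mul_right ?_ (pow_pos hR (k + 1)).le
          rw [ham, hpm]
          have := hlt (k + 1) k.lt_succ_self
          nlinarith [norm_nonneg a, (by positivity : 0 ≤ ‖p.coeff (k + 1)‖ * R ^ (k + 1))]
        rw [hcoef, sub_eq_add_neg, IsUltrametricDist.norm_add_eq_max_of_norm_ne_norm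
          (by rw [norm_neg]; exact h2.ne'), norm_neg, max_eq_left h2.le, hpm]
      refine ⟨k + 1, ?_, fun m => ?_, fun m hm => ?_⟩
      · rw [hk]
        exact (Multiset.countP_cons_of_pos (p := fun a => ‖a‖ ≤ R) s ha).symm
      · rw [htop]
        rcases m with _ | m
        · rw [hcoef0, norm_neg, ham]
          exact mul_le_mul ha (hle 0) (by positivity) hR.le
        · rw [hcoef]
          refine (mul_le_mul_of_nonneg_right (hsub _ _) (by positivity)).trans ?_
          rw [max_mul_of_nonneg _ _ (by positivity), hpm, ham]
          exact max_le (mul_le_mul_of_nonneg_left (hle m) hR.le)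
            (mul_le_mul ha (hle _) (by positivity) hR.le)
      · rw [htop]
        rcases m with _ | m
        · omega
        · rw [hcoef]
          refine (mul_le_mul_of_nonneg_right (hsub _ _) (by positivity)).trans_lt ?_
          rw [max_mul_of_nonneg _ _ (by positivity), hpm, ham]
          have h1 := hlt m (by omega)
          have h2 := hlt (m + 1) (by omega)
          refine max_lt (mul_lt_mul_of_pos_left h1 hR) ?_
          exact (mul_le_mul_of_nonneg_right ha (by positivity)).trans_lt
            (mul_lt_mul_of_pos_left h2 hR)
    · have ha' := not_le.mp ha
      have hapos := hR.trans ha'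
      have htop : ‖((X - Polynomial.C a) * p).coeff k‖ * R ^ k = ‖a‖ * T := by
        rcases k with _ | k
        · rw [hcoef0, norm_neg, ham]
        · have h2 : ‖p.coeff k‖ < ‖a * p.coeff (k + 1)‖ := by
            refine lt_of_mul_lt_mul_right ?_ (pow_pos hR (k + 1)).le
            rw [ham, hpm]
            exact (mul_le_mul_of_nonneg_left (hle k) hR.le).trans_lt
              (mul_lt_mul_of_pos_right ha' hT0)
          rw [hcoef, sub_eq_add_neg, IsUltrametricDist.norm_add_eq_max_of_norm_ne_norm
            (by rw [norm_neg]; exact h2.ne), norm_neg, max_eq_right h2.le, ham]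
      refine ⟨k, ?_, fun m => ?_, fun m hm => ?_⟩
      · rw [hk]
        exact (Multiset.countP_cons_of_neg (p := fun a => ‖a‖ ≤ R) s ha).symm
      · rw [htop]
        rcases m with _ | m
        · rw [hcoef0, norm_neg, ham]
          exact mul_le_mul_of_nonneg_left (hle 0) (norm_nonneg _)
        · rw [hcoef]
          refine (mul_le_mul_of_nonneg_right (hsub _ _) (by positivity)).trans ?_
          rw [max_mul_of_nonneg _ _ (by positivity), hpm, ham]
          exact max_le (mul_le_mul ha'.le (hle m) (by positivity) (norm_nonneg _))
            (mul_le_mul_of_nonneg_left (hle _) (norm_nonneg _))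
      · rw [htop]
        rcases m with _ | m
        · omega
        · rw [hcoef]
          refine (mul_le_mul_of_nonneg_right (hsub _ _) (by positivity)).trans_lt ?_
          rw [max_mul_of_nonneg _ _ (by positivity), hpm, ham]
          refine max_lt ?_ (mul_lt_mul_of_pos_left (hlt (m + 1) (by omega)) hapos)
          exact (mul_le_mul_of_nonneg_left (hle m) hR.le).trans_lt
            (mul_lt_mul_of_pos_right ha' hT0)

theorem norm_coeff_le_countP_roots [IsUltrametricDist C] [IsAlgClosed C] {p : C[X]} (hp : p ≠ 0)
    {R : ℝ} (hR : 0 < R) :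
    ∃ k : ℕ, k = Multiset.countP (fun a => ‖a‖ ≤ R) p.roots ∧
      (∀ m, ‖p.coeff m‖ * R ^ m ≤ ‖p.coeff k‖ * R ^ k) ∧
      ∀ m, k < m → ‖p.coeff m‖ * R ^ m < ‖p.coeff k‖ * R ^ k := by
  obtain ⟨k, hk, hle, hlt⟩ := norm_coeff_multiset_prod_le p.roots hR
  have h := (IsAlgClosed.splits p).eq_prod_roots
  have hc : ∀ m, ‖p.coeff m‖ * R ^ m = ‖p.leadingCoeff‖ *
      (‖(p.roots.map fun a => X - Polynomial.C a).prod.coeff m‖ * R ^ m) := by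
    intro m
    conv_lhs => rw [h, coeff_C_mul, norm_mul]
    ring
  refine ⟨k, hk, fun m => ?_, fun m hm => ?_⟩
  · rw [hc, hc]
    exact mul_le_mul_of_nonneg_left (hle m) (norm_nonneg _)
  · rw [hc, hc]
    exact mul_lt_mul_of_pos_left (hlt m hm) (norm_pos_iff.mpr (leadingCoeff_ne_zero.mpr hp))

variable {Fq : Type*} [Field Fq] [Fintype Fq] [IsAlgClosed C] [Algebra Fq C]

variable (Fq) in
/-- After composing with a power of `τ`, a finite sum of terms `a_n τ^n` is a polynomial. -/
theorem exists_polynomial_eval_eq (a : ℤ → C) (s : Finset ℤ) :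
    ∃ (M : ℕ) (e : ℤ → ℕ) (p : C[X]), (∀ m ∈ s, ∀ n ∈ s, m < n → e m < e n) ∧ (∀ n, 0 < e n) ∧
      (∀ z, p.eval z = (frob Fq C ^ M) (∑ n ∈ s, a n * (frob Fq C ^ n) z)) ∧
      (∀ k, p.coeff k ≠ 0 → ∃ n ∈ s, k = e n) ∧
      ∀ n ∈ s, ∀ R : ℝ, 0 < R → ‖p.coeff (e n)‖ * R ^ e n =
        (‖a n‖ * R ^ ((Fintype.card Fq : ℝ) ^ n)) ^ (Fintype.card Fq ^ M) := by
  obtain ⟨B, hB⟩ := s.bddBelow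
  obtain ⟨M, hM⟩ : ∃ M : ℕ, ∀ n ∈ s, -(M : ℤ) ≤ n :=
    ⟨(-B).toNat, fun n hn => by have := hB hn; omega⟩
  have hq : 1 < Fintype.card Fq := Fintype.one_lt_card
  set e : ℤ → ℕ := fun n => Fintype.card Fq ^ (n + M).toNat with he
  have hmono : ∀ m ∈ s, ∀ n ∈ s, m < n → e m < e n := by
    intro m hm n hn hmn
    have := hM m hm
    have := hM n hn
    exact Nat.pow_lt_pow_right hq (by omega)
  have hinj : ∀ m ∈ s, ∀ n ∈ s, e m = e n → m = n := by
    intro m hm n hn hmn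
    rcases lt_trichotomy m n with h | h | h
    · exact absurd hmn (hmono m hm n hn h).ne
    · exact h
    · exact absurd hmn (hmono n hn m hm h).ne'
  set p : C[X] := ∑ n ∈ s, Polynomial.C ((frob Fq C ^ M) (a n)) * X ^ e n with hp
  have hpc : ∀ k, p.coeff k = ∑ n ∈ s, if k = e n then (frob Fq C ^ M) (a n) else 0 := by
    intro k
    simp [hp, coeff_X_pow]
  have hfe : ∀ n ∈ s, ∀ z : C, (frob Fq C ^ M) ((frob Fq C ^ n) z) = z ^ e n := by
    intro n hn z
    rw [← zpow_natCast, ← frob_zpow_add_apply]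
    have h : (M : ℤ) + n = ((n + M).toNat : ℤ) := by have := hM n hn; omega
    rw [h, zpow_natCast, frob_pow_apply]
  refine ⟨M, e, p, hmono, fun n => pow_pos (by omega) _, fun z => ?_, fun k hk => ?_,
    fun n hn R hR => ?_⟩
  · rw [map_sum, hp, eval_finsetSum]
    refine Finset.sum_congr rfl fun n hn => ?_
    rw [map_mul, hfe n hn]
    simp
  · rw [hpc] at hk
    obtain ⟨n, hn, h⟩ := Finset.exists_ne_zero_of_sum_ne_zero hk
    exact ⟨n, hn, by by_contra hc; simp [hc] at h⟩
  · have h1 : p.coeff (e n) = (frob Fq C ^ M) (a n) := by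
      rw [hpc, Finset.sum_eq_single n]
      · simp
      · intro m hm hmn
        rw [if_neg fun h => hmn (hinj _ hn _ hm h).symm]
      · exact fun h => absurd hn h
    rw [h1, frob_pow_apply, norm_pow, mul_pow]
    congr 1
    rw [← Real.rpow_natCast (R ^ _), ← Real.rpow_mul hR.le, ← Real.rpow_natCast]
    congr 1
    have hq0 : (Fintype.card Fq : ℝ) ≠ 0 := by positivity
    have hn' : ((n + M).toNat : ℤ) = n + M := by have := hM n hn; omega
    simp only [he, Nat.cast_pow]
    rw [← zpow_natCast, hn', zpow_add₀ hq0, zpow_natCast]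

variable (Fq) in
/-- A finite sum `∑ a_n τ^n` takes on the disk of radius `R` every value of size at most
`|a_n| R^(q^n)`: otherwise the constant term of the corresponding polynomial would dominate at
radius `R`. -/
theorem exists_sum_frob_eq [IsUltrametricDist C] (a : ℤ → C) (s : Finset ℤ) {R : ℝ}
    (hR : 0 < R) {y : C} {n : ℤ} (hn : n ∈ s) (hy : ‖y‖ ≤ ‖a n‖ * R ^ ((Fintype.card Fq : ℝ) ^ n)) :
    ∃ z : C, ‖z‖ ≤ R ∧ ∑ n ∈ s, a n * (frob Fq C ^ n) z = y := by
  rcases eq_or_ne y 0 with rfl | hy0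
  · exact ⟨0, by simpa using hR.le, by simp⟩
  obtain ⟨M, e, p, -, hepos, heval, hcoef, hnorm⟩ := exists_polynomial_eval_eq Fq a s
  set P := p - Polynomial.C ((frob Fq C ^ M) y) with hP
  have hp0 : p.coeff 0 = 0 := by
    by_contra h
    obtain ⟨m, -, hm⟩ := hcoef 0 h
    exact (hepos m).ne hm
  have hP0 : P.coeff 0 = -(frob Fq C ^ M) y := by simp [hP, hp0]
  have hPe : P.coeff (e n) = p.coeff (e n) := by
    simp [hP, coeff_C, (hepos n).ne']
  have hPne : P ≠ 0 := by
    intro h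
    rw [h, coeff_zero, eq_comm, neg_eq_zero, map_eq_zero_iff _ (AlgEquiv.injective _)] at hP0
    exact hy0 hP0
  obtain ⟨k, hk, -, hlt⟩ := norm_coeff_le_countP_roots hPne hR
  have hkpos : 0 < k := by
    by_contra! h
    obtain rfl : k = 0 := by omega
    have h1 := hlt (e n) (hepos n)
    rw [hPe, hnorm n hn R hR, hP0, norm_neg, frob_pow_apply, norm_pow, pow_zero, mul_one] at h1
    exact absurd h1 (not_lt.mpr (pow_le_pow_left₀ (norm_nonneg _) hy _))
  rw [hk, Multiset.countP_pos] at hkpos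
  obtain ⟨z, hz, hzR⟩ := hkpos
  refine ⟨z, hzR, (frob Fq C ^ M).injective ?_⟩
  rw [← heval]
  have := (mem_roots hPne).mp hz
  simpa [hP, IsRoot.def, sub_eq_zero] using this

variable (Fq) in
/-- If `m < n` are indices such that the `m`-th term dominates all later ones at radius `ρ` and the
`n`-th term dominates at radius `R`, the finite sum has a zero between these radii. -/
theorem exists_sum_frob_eq_zero [IsUltrametricDist C] (a : ℤ → C) (s : Finset ℤ) {ρ R : ℝ}
    (hρ : 0 < ρ) (hρR : ρ ≤ R) {m n : ℤ} (hmn : m < n) (hn : n ∈ s) (hm : m ∈ s)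
    (hlt : ∀ k ∈ s, m < k → ‖a k‖ * ρ ^ ((Fintype.card Fq : ℝ) ^ k) <
      ‖a m‖ * ρ ^ ((Fintype.card Fq : ℝ) ^ m))
    (hle : ∀ k ∈ s, ‖a k‖ * R ^ ((Fintype.card Fq : ℝ) ^ k) ≤
      ‖a n‖ * R ^ ((Fintype.card Fq : ℝ) ^ n)) :
    ∃ z : C, ρ < ‖z‖ ∧ ‖z‖ ≤ R ∧ ∑ n ∈ s, a n * (frob Fq C ^ n) z = 0 := by
  have hR := hρ.trans_le hρR
  obtain ⟨M, e, p, hmono, hepos, heval, hcoef, hnorm⟩ := exists_polynomial_eval_eq Fq a s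
  have hqM : Fintype.card Fq ^ M ≠ 0 := pow_ne_zero _ Fintype.card_ne_zero
  have hpm : p.coeff (e m) ≠ 0 := by
    intro h
    have h1 := hnorm m hm ρ hρ
    rw [h, norm_zero, zero_mul, eq_comm, pow_eq_zero_iff hqM] at h1
    have h2 := hlt n hn hmn
    rw [h1] at h2
    exact absurd h2 (not_lt.mpr (by positivity))
  have hpne : p ≠ 0 := fun h => hpm (by simp [h])
  obtain ⟨k₁, hk₁, hle₁, hlt₁⟩ := norm_coeff_le_countP_roots hpne hρ
  obtain ⟨k₂, hk₂, hle₂, hlt₂⟩ := norm_coeff_le_countP_roots hpne hR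
  have hne : ∀ k (S : ℝ), 0 < S → (∀ j, k < j → ‖p.coeff j‖ * S ^ j < ‖p.coeff k‖ * S ^ k) →
      p.coeff k ≠ 0 := by
    intro k S hS h h0
    have h1 := h (k + 1) k.lt_succ_self
    rw [h0, norm_zero, zero_mul] at h1
    exact absurd h1 (not_lt.mpr (by positivity))
  obtain ⟨j₁, hj₁, rfl⟩ := hcoef k₁ (hne k₁ ρ hρ hlt₁)
  have hj₁m : j₁ ≤ m := by
    by_contra! h
    have h1 := hle₁ (e m)
    rw [hnorm m hm ρ hρ, hnorm j₁ hj₁ ρ hρ] at h1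
    exact absurd h1 (not_le.mpr (pow_lt_pow_left₀ (hlt j₁ hj₁ h) (by positivity) hqM))
  have hk₂n : e n ≤ k₂ := by
    by_contra! h
    have h1 := hlt₂ (e n) h
    obtain ⟨j₂, hj₂, rfl⟩ := hcoef k₂ (hne k₂ R hR hlt₂)
    rw [hnorm n hn R hR, hnorm j₂ hj₂ R hR] at h1
    exact absurd h1 (not_lt.mpr (pow_le_pow_left₀ (by positivity) (hle j₂ hj₂) _))
  have hlt12 : e j₁ < k₂ := (hmono j₁ hj₁ n hn (hj₁m.trans_lt hmn)).trans_le hk₂n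
  by_contra! hno
  have hcount : Multiset.countP (fun a => ‖a‖ ≤ R) p.roots =
      Multiset.countP (fun a => ‖a‖ ≤ ρ) p.roots := by
    refine Multiset.countP_congr rfl fun z hz => propext ⟨fun h => ?_, fun h => h.trans hρR⟩
    by_contra! h2
    refine hno z h2 h ((frob Fq C ^ M).injective ?_)
    rw [← heval, map_zero]
    exact (mem_roots hpne).mp hz
  omega

end Poly

namespace FSeries

variable {Fq C : Type*} [Field Fq] [Fintype Fq] [NormedField C] [IsAlgClosed C] [Algebra Fq C]
  [IsUltrametricDist C] [CompleteSpace C]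

/-- The terms outside a large finite set contribute at most `ε` on the disk of radius `R`. -/
theorem exists_finset_norm_sub_sum_le (f : FSeries Fq C) {R : ℝ} (hR : 0 ≤ R) {ε : ℝ}
    (hε : 0 < ε) (t : Finset ℤ) : ∃ s : Finset ℤ, t ⊆ s ∧ ∀ z : C, ‖z‖ ≤ R →
      ‖f.toLinearMap z - ∑ n ∈ s, f.coeff n * (frob Fq C ^ n) z‖ ≤ ε := by
  classical
  have h1 := (f.tendsto_termNorm hR).eventually_lt_const hε
  rw [eventually_cofinite] at h1
  refine ⟨t ∪ h1.toFinset, Finset.subset_union_left, fun z hz => ?_⟩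
  rw [toLinearMap_apply, ← (f.summable z).sum_add_tsum_subtype_compl (t ∪ h1.toFinset),
    add_sub_cancel_left]
  refine norm_tsum_le_of_ultra hε.le fun n => ?_
  rw [norm_term]
  have hn := n.2
  simp only [Finset.mem_union, Set.Finite.mem_toFinset, Set.mem_ofPred_eq, not_or, not_not] at hn
  exact (f.termNorm_mono (norm_nonneg z) hz _).trans hn.2.le

/-- `f` maps the disk of radius `R` onto the disk of radius `|f|_R`. -/
theorem exists_toLinearMap_eq (f : FSeries Fq C) {R : ℝ} (hR : 0 < R) {y : C}
    (hy : ‖y‖ ≤ f.gaussNorm R) : ∃ z : C, ‖z‖ ≤ R ∧ f.toLinearMap z = y := by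
  rcases eq_or_ne f 0 with rfl | hf
  · refine ⟨0, by simpa using hR.le, ?_⟩
    have : (0 : FSeries Fq C).gaussNorm R ≤ 0 := gaussNorm_le fun n => by simp [termNorm]
    rw [map_zero, eq_comm, ← norm_le_zero_iff]
    exact hy.trans this
  -- solve a truncated equation at radius `R`, leaving an error of size at most `|f|_R'`
  have step : ∀ (R R' : ℝ), 0 < R → 0 < R' → ∀ y : C, ‖y‖ ≤ f.gaussNorm R →
      ∃ z : C, ‖z‖ ≤ R ∧ ‖y - f.toLinearMap z‖ ≤ f.gaussNorm R' := by
    intro R R' hR hR' y hy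
    obtain ⟨n, hn⟩ := exists_isTop hf hR
    obtain ⟨s, hs, hsum⟩ := f.exists_finset_norm_sub_sum_le hR.le (gaussNorm_pos hf hR') {n}
    rw [hn.gaussNorm_eq hR.le] at hy
    obtain ⟨z, hz, rfl⟩ := exists_sum_frob_eq Fq f.coeff s hR (hs (Finset.mem_singleton_self n)) hy
    exact ⟨z, hz, by rw [norm_sub_rev]; exact hsum z hz⟩
  set r : ℕ → ℝ := fun k => R / 2 ^ k with hr
  have hr0 : ∀ k, 0 < r k := fun k => by positivity
  have hrle : ∀ k, r k ≤ R := fun k => div_le_self hR.le (one_le_pow₀ one_le_two)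
  have hrlim : Tendsto r atTop (𝓝 0) := by
    have := (tendsto_pow_atTop_nhds_zero_of_lt_one (r := (1 / 2 : ℝ)) (by norm_num)
      (by norm_num)).const_mul R
    simpa [hr, div_eq_mul_inv] using this
  have step' : ∀ (k : ℕ) (x : {x : C // ‖y - f.toLinearMap x‖ ≤ f.gaussNorm (r k)}),
      ∃ x' : {x : C // ‖y - f.toLinearMap x‖ ≤ f.gaussNorm (r (k + 1))},
        ‖(x' : C) - x‖ ≤ r k := by
    rintro k ⟨x, hx⟩
    obtain ⟨z, hz, hz'⟩ := step (r k) (r (k + 1)) (hr0 _) (hr0 _) _ hx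
    exact ⟨⟨x + z, by rwa [map_add, ← sub_sub]⟩, by simpa using hz⟩
  choose F hF using step'
  let x : ∀ k : ℕ, {x : C // ‖y - f.toLinearMap x‖ ≤ f.gaussNorm (r k)} :=
    fun k => Nat.rec ⟨0, by simpa [hr] using hy⟩ (fun k x => F k x) k
  have hx : ∀ k, ‖(x (k + 1)).1 - (x k).1‖ ≤ r k := fun k => hF k (x k)
  have hcauchy : CauchySeq fun k => (x k).1 := by
    refine NonarchimedeanAddGroup.cauchySeq_of_tendsto_sub_nhds_zero ?_
    rw [tendsto_zero_iff_norm_tendsto_zero]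
    exact squeeze_zero (fun _ => norm_nonneg _) hx hrlim
  obtain ⟨z, hz⟩ := cauchySeq_tendsto_of_complete hcauchy
  have hxR : ∀ k, ‖(x k).1‖ ≤ R := by
    intro k
    induction k with
    | zero => simpa [x] using hR.le
    | succ k ih =>
      have := IsUltrametricDist.norm_add_le_max ((x (k + 1)).1 - (x k).1) (x k).1
      rw [sub_add_cancel] at this
      exact this.trans (max_le ((hx k).trans (hrle k)) ih)
  refine ⟨z, le_of_tendsto hz.norm (Eventually.of_forall hxR), ?_⟩
  have h1 : Tendsto (fun k => y - f.toLinearMap (x k).1) atTop (𝓝 (y - f.toLinearMap z)) :=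
    ((f.continuous_toLinearMap.tendsto z).comp hz).const_sub y
  have h2 : Tendsto (fun k => y - f.toLinearMap (x k).1) atTop (𝓝 0) := by
    rw [Metric.tendsto_atTop]
    intro ε hε
    obtain ⟨δ, hδ, h⟩ := f.exists_forall_gaussNorm_le (half_pos hε)
    obtain ⟨N, hN⟩ := eventually_atTop.mp (hrlim.eventually_le_const hδ)
    refine ⟨N, fun k hk => ?_⟩
    rw [dist_zero_right]
    exact ((x k).2.trans (h _ (hr0 k).le (hN k hk))).trans_lt (half_lt_self hε)
  exact (sub_eq_zero.mp (tendsto_nhds_unique h1 h2)).symm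

/-- If the top index jumps between the radii `ρ` and `R`, then `f` has a zero in between. -/
theorem exists_mem_ker_of_isTop_lt {f : FSeries Fq C} {ρ R : ℝ} (hρ : 0 < ρ) (hρR : ρ ≤ R) {m n : ℤ}
    (hm : f.IsTop ρ m) (hn : f.IsTop R n) (hmn : m < n) :
    ∃ w ∈ f.ker, ρ < ‖w‖ ∧ ‖w‖ ≤ R := by
  have hR := hρ.trans_le hρR
  have hf := hm.ne_zero hρ.le
  obtain ⟨s, hs, hsum⟩ := f.exists_finset_norm_sub_sum_le hR.le (gaussNorm_pos hf hρ) {m, n}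
  obtain ⟨z, hz1, hz2, hz⟩ := exists_sum_frob_eq_zero Fq f.coeff s hρ hρR hmn (hs (by simp))
    (hs (by simp)) (fun k _ => hm.lt k) (fun k _ => hn.le k)
  have h1 := hsum z hz2
  rw [hz, sub_zero] at h1
  obtain ⟨z', hz', hzz⟩ := f.exists_toLinearMap_eq hρ h1
  have hnorm : ‖z - z'‖ = ‖z‖ := by
    have h := hz'.trans_lt hz1
    rw [sub_eq_add_neg, IsUltrametricDist.norm_add_eq_max_of_norm_ne_norm
      (by rw [norm_neg]; exact h.ne'), norm_neg, max_eq_left h.le]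
  exact ⟨z - z', by rw [mem_ker, map_sub, hzz, sub_self], by rwa [hnorm], by rwa [hnorm]⟩

end FSeries

/-! ### Right division by a linear factor -/

namespace FSeries

variable {Fq C : Type*} [Field Fq] [Fintype Fq] [NormedField C] [IsAlgClosed C] [Algebra Fq C]

theorem frob_neg_one_frob (z : C) : (frob Fq C ^ (-1 : ℤ)) (frob Fq C z) = z := by
  simp

theorem frob_frob_neg_one (z : C) : frob Fq C ((frob Fq C ^ (-1 : ℤ)) z) = z := by
  simp

/-- `f = h ∘ (1 - b τ⁻¹)`, expressed through the coefficients. -/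
def IsRightFactor (f h : FSeries Fq C) (b : C) : Prop :=
  ∀ n, f.coeff n = h.coeff n - h.coeff (n + 1) * (frob Fq C ^ (n + 1)) b

variable (Fq) in
theorem exists_sub_mul_frob_eq (b x : C) : ∃ z : C, z - b * (frob Fq C ^ (-1 : ℤ)) z = x := by
  have hq : 1 < Fintype.card Fq := Fintype.one_lt_card
  obtain ⟨y, hy⟩ := IsAlgClosed.exists_root
    (Polynomial.X ^ Fintype.card Fq - (Polynomial.C b * Polynomial.X + Polynomial.C x) :
      Polynomial C) (by
    rw [Polynomial.degree_sub_eq_left_of_degree_lt]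
    · rw [Polynomial.degree_X_pow]
      exact_mod_cast (by omega : Fintype.card Fq ≠ 0)
    · rw [Polynomial.degree_X_pow]
      exact Polynomial.degree_linear_le.trans_lt (by exact_mod_cast hq))
  refine ⟨frob Fq C y, ?_⟩
  rw [frob_neg_one_frob, frob_apply]
  simp only [Polynomial.IsRoot.def, Polynomial.eval_sub, Polynomial.eval_pow, Polynomial.eval_X,
    Polynomial.eval_add, Polynomial.eval_mul, Polynomial.eval_C] at hy
  linear_combination hy

theorem termNorm_snd (h : FSeries Fq C) (b : C) {R : ℝ} (hR : 0 < R) (n : ℤ) :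
    ‖h.coeff (n + 1) * (frob Fq C ^ (n + 1)) b‖ * R ^ ((Fintype.card Fq : ℝ) ^ n) =
      h.termNorm (‖b‖ * R ^ ((Fintype.card Fq : ℝ)⁻¹)) (n + 1) := by
  have hq : (Fintype.card Fq : ℝ) ≠ 0 := by positivity
  rw [termNorm, norm_mul, norm_frob_zpow_apply, Real.mul_rpow (norm_nonneg _) (by positivity),
    ← Real.rpow_mul hR.le, zpow_add_one₀ hq, mul_assoc]
  congr 4
  field_simp

/-- The radius `|b| R^(1/q)` for `b = w / w^(1/q)`. -/
theorem norm_div_frob_mul_rpow (w : C) {R : ℝ} (hR : 0 < R) :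
    ‖w / (frob Fq C ^ (-1 : ℤ)) w‖ * R ^ ((Fintype.card Fq : ℝ)⁻¹) =
      ‖w‖ * (R / ‖w‖) ^ ((Fintype.card Fq : ℝ)⁻¹) := by
  rw [norm_div, norm_frob_zpow_apply, zpow_neg_one, Real.div_rpow hR.le (norm_nonneg _)]
  ring

variable [IsUltrametricDist C]

theorem IsRightFactor.termNorm_le {f h : FSeries Fq C} {b : C} (hfh : IsRightFactor f h b)
    {R : ℝ} (hR : 0 < R) (n : ℤ) :
    f.termNorm R n ≤
      max (h.termNorm R n) (h.termNorm (‖b‖ * R ^ ((Fintype.card Fq : ℝ)⁻¹)) (n + 1)) := by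
  rw [← termNorm_snd h b hR, termNorm, termNorm, hfh n, ← max_mul_of_nonneg _ _ (by positivity)]
  refine mul_le_mul_of_nonneg_right ?_ (by positivity)
  rw [sub_eq_add_neg, ← norm_neg (h.coeff (n + 1) * _)]
  exact IsUltrametricDist.norm_add_le_max _ _

theorem IsRightFactor.termNorm_eq {f h : FSeries Fq C} {b : C} (hfh : IsRightFactor f h b)
    {R : ℝ} (hR : 0 < R) (n : ℤ)
    (hne : h.termNorm R n ≠ h.termNorm (‖b‖ * R ^ ((Fintype.card Fq : ℝ)⁻¹)) (n + 1)) :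
    f.termNorm R n =
      max (h.termNorm R n) (h.termNorm (‖b‖ * R ^ ((Fintype.card Fq : ℝ)⁻¹)) (n + 1)) := by
  rw [← termNorm_snd h b hR] at hne ⊢
  rw [termNorm, termNorm, hfh n, ← max_mul_of_nonneg _ _ (by positivity), sub_eq_add_neg,
    ← norm_neg (h.coeff (n + 1) * _), IsUltrametricDist.norm_add_eq_max_of_norm_ne_norm]
  intro h1
  rw [norm_neg] at h1
  exact hne (by rw [termNorm, h1])

/-- At radii beyond the zero of the linear factor, the factor does not move the top index. -/
theorem IsRightFactor.isTop_of_le {f h : FSeries Fq C} {b : C} (hfh : IsRightFactor f h b)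
    {R : ℝ} (hR : 0 < R) (hb : ‖b‖ * R ^ ((Fintype.card Fq : ℝ)⁻¹) ≤ R) {n : ℤ}
    (hn : h.IsTop R n) : f.IsTop R n := by
  have hmono := fun m => h.termNorm_mono (by positivity) hb m
  have h1 : f.termNorm R n = h.termNorm R n := by
    have h2 := (hmono (n + 1)).trans_lt (hn.lt (n + 1) (lt_add_one n))
    rw [hfh.termNorm_eq hR n h2.ne', max_eq_left h2.le]
  refine ⟨fun m => ?_, fun m hm => ?_⟩ <;> rw [h1]
  · exact (hfh.termNorm_le hR m).trans (max_le (hn.le m) ((hmono _).trans (hn.le _)))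
  · exact (hfh.termNorm_le hR m).trans_lt
      (max_lt (hn.lt m hm) ((hmono _).trans_lt (hn.lt _ (by omega))))

/-- At radii below the zero of the linear factor, the factor lowers the top index by one. -/
theorem IsRightFactor.isTop_of_lt {f h : FSeries Fq C} {b : C} (hfh : IsRightFactor f h b)
    {R : ℝ} (hR : 0 < R) (hb : R < ‖b‖ * R ^ ((Fintype.card Fq : ℝ)⁻¹)) {n : ℤ}
    (hn : h.IsTop (‖b‖ * R ^ ((Fintype.card Fq : ℝ)⁻¹)) n) : f.IsTop R (n - 1) := by
  set R' := ‖b‖ * R ^ ((Fintype.card Fq : ℝ)⁻¹) with hR'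
  have hmono := fun m => h.termNorm_mono hR.le hb.le m
  have hpos : 0 < h.termNorm R' n :=
    h.termNorm_pos (hR.trans hb) (hn.coeff_ne_zero (hR.trans hb).le)
  have h1 : f.termNorm R (n - 1) = h.termNorm R' n := by
    have h2 : h.termNorm R (n - 1) < h.termNorm R' n := by
      by_cases h0 : h.coeff (n - 1) = 0
      · rw [termNorm, h0, norm_zero, zero_mul]; exact hpos
      · exact (h.termNorm_lt_of_ne_zero hR.le hb h0).trans_le (hn.le _)
    have h3 := hfh.termNorm_eq hR (n - 1)
    rw [← hR', sub_add_cancel] at h3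
    rw [h3 h2.ne, max_eq_right h2.le]
  refine ⟨fun m => ?_, fun m hm => ?_⟩ <;> rw [h1]
  · exact (hfh.termNorm_le hR m).trans (max_le ((hmono _).trans (hn.le m)) (hn.le _))
  · by_cases hmn : m = n
    · subst hmn
      refine (hfh.termNorm_le hR m).trans_lt (max_lt ?_ (hn.lt _ (by omega)))
      exact h.termNorm_lt_of_ne_zero hR.le hb (hn.coeff_ne_zero (hR.trans hb).le)
    · exact (hfh.termNorm_le hR m).trans_lt
        (max_lt ((hmono _).trans_lt (hn.lt m (by omega))) (hn.lt _ (by omega)))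

variable [CompleteSpace C]

/-- Coefficients of the quotient: the tails `∑_{m ≥ n} a_m w^(q^m)` of the vanishing sum `f(w)`,
divided by `w^(q^n)`. For `n → -∞` these tails tend to zero because `f(w) = 0`. -/
theorem exists_isRightFactor (f : FSeries Fq C) {w : C} (hw : w ≠ 0) (hf : w ∈ f.ker) :
    ∃ h : FSeries Fq C, IsRightFactor f h (w / (frob Fq C ^ (-1 : ℤ)) w) := by
  set x : ℤ → C := fun m => f.coeff m * (frob Fq C ^ m) w with hx
  have hxn : ∀ m, ‖x m‖ = f.termNorm ‖w‖ m := fun m => f.norm_term m w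
  have hx0 : ∑' m, x m = 0 := hf
  set T : ℤ → C := fun n => ∑' m, if n ≤ m then x m else 0 with hT
  have hw0 : ∀ n : ℤ, (frob Fq C ^ n) w ≠ 0 := fun n => by
    rwa [Ne, map_eq_zero_iff _ (AlgEquiv.injective _)]
  have hsum : Summable x := f.summable w
  have hsumT : ∀ n, Summable fun m => if n ≤ m then x m else 0 := fun n => by
    have := hsum.indicator (Set.Ici n)
    refine this.congr fun m => ?_
    classical rw [Set.indicator_apply]
    rfl
  have hTs : ∀ n, T n = x n + T (n + 1) := by
    intro n
    have h1 := (hsumT n).tsum_eq_add_tsum_ite n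
    rw [hT]
    refine h1.trans ?_
    rw [if_pos le_rfl]
    congr 1
    refine tsum_congr fun m => ?_
    by_cases h : m = n
    · simp [h]
    · rw [if_neg h]
      exact if_congr (by omega) rfl rfl
  have hTle : ∀ n B, 0 ≤ B → (∀ m, n ≤ m → ‖x m‖ ≤ B) → ‖T n‖ ≤ B := by
    intro n B hB h
    refine norm_tsum_le_of_ultra hB fun m => ?_
    split_ifs with hm
    · exact h m hm
    · simpa using hB
  have hTle' : ∀ n B, 0 ≤ B → (∀ m, m < n → ‖x m‖ ≤ B) → ‖T n‖ ≤ B := by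
    intro n B hB h
    have h1 : T n = - ∑' m, if n ≤ m then 0 else x m := by
      have h2 : Summable fun m => if n ≤ m then 0 else x m := by
        refine (hsum.sub (hsumT n)).congr fun m => ?_
        split_ifs <;> simp
      rw [eq_neg_iff_add_eq_zero, hT, ← (hsumT n).tsum_add h2]
      refine Eq.trans ?_ hx0
      refine tsum_congr fun m => ?_
      split_ifs <;> simp
    rw [h1, norm_neg]
    refine norm_tsum_le_of_ultra hB fun m => ?_
    split_ifs with hm
    · simpa using hB
    · exact h m (not_le.mp hm)
  have hwpos := norm_pos_iff.mpr hw
  obtain ⟨h, hh⟩ := exists_of_tendsto_termNorm (Fq := Fq) (fun n => T n / (frob Fq C ^ n) w) (by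
    intro R hR
    set S := max R ‖w‖ with hS
    have hS0 : 0 < S := hR.trans_le (le_max_left _ _)
    have hbound : ∀ n : ℤ, ‖T n / (frob Fq C ^ n) w‖ * R ^ ((Fintype.card Fq : ℝ) ^ n) ≤
        ‖T n‖ * (S / ‖w‖) ^ ((Fintype.card Fq : ℝ) ^ n) := by
      intro n
      rw [norm_div, norm_frob_zpow_apply, Real.div_rpow hS0.le hwpos.le, div_mul_eq_mul_div,
        mul_div_assoc]
      have := Real.rpow_le_rpow hR.le (le_max_left R ‖w‖) (card_zpow_pos Fq n).le
      gcongr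
    have hSw : 1 ≤ S / ‖w‖ := (one_le_div hwpos).mpr (le_max_right _ _)
    refine squeeze_zero (fun n => by positivity) hbound ?_
    have h0 := f.tendsto_termNorm hS0.le
    rw [Int.cofinite_eq, tendsto_sup] at h0 ⊢
    constructor
    · rw [Metric.tendsto_nhds]
      intro ε hε
      have hε' : 0 < ε / 2 / (S / ‖w‖) := by positivity
      obtain ⟨N, hN⟩ := eventually_atBot.mp (h0.1.eventually_lt_const hε')
      filter_upwards [eventually_le_atBot (min N 0)] with n hn
      rw [Real.dist_eq, sub_zero, abs_of_nonneg (by positivity)]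
      have h1 : ‖T n‖ ≤ ε / 2 / (S / ‖w‖) := by
        refine hTle' n _ hε'.le fun m hm => ?_
        rw [hxn]
        exact (f.termNorm_mono hwpos.le (le_max_right _ _) m).trans (hN m (by omega)).le
      have h2 : (S / ‖w‖) ^ ((Fintype.card Fq : ℝ) ^ n) ≤ S / ‖w‖ := by
        conv_rhs => rw [← Real.rpow_one (S / ‖w‖)]
        refine Real.rpow_le_rpow_of_exponent_le hSw ?_
        simpa using card_zpow_le Fq (show n ≤ 0 by omega)
      calc _ ≤ ε / 2 / (S / ‖w‖) * (S / ‖w‖) := mul_le_mul h1 h2 (by positivity) hε'.le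
        _ = ε / 2 := div_mul_cancel₀ _ (by positivity)
        _ < ε := half_lt_self hε
    · rw [Metric.tendsto_nhds]
      intro ε hε
      obtain ⟨N, hN⟩ := eventually_atTop.mp (h0.2.eventually_lt_const (half_pos hε))
      filter_upwards [eventually_ge_atTop N] with n hn
      rw [Real.dist_eq, sub_zero, abs_of_nonneg (by positivity)]
      have h1 : ‖T n‖ ≤ ε / 2 * (‖w‖ / S) ^ ((Fintype.card Fq : ℝ) ^ n) := by
        refine hTle n _ (by positivity) fun m hm => ?_
        have h3 : f.termNorm ‖w‖ m =
            f.termNorm S m * (‖w‖ / S) ^ ((Fintype.card Fq : ℝ) ^ m) := by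
          rw [termNorm, termNorm, mul_assoc, ← Real.mul_rpow hS0.le (by positivity),
            mul_div_cancel₀ _ hS0.ne']
        rw [hxn, h3]
        refine mul_le_mul (hN m (hn.trans hm)).le ?_ (by positivity) (by positivity)
        exact Real.rpow_le_rpow_of_exponent_ge (by positivity)
          ((div_le_one hS0).mpr (le_max_right _ _)) (card_zpow_le Fq hm)
      refine (mul_le_mul_of_nonneg_right h1 (by positivity)).trans_lt ?_
      rw [mul_assoc, ← Real.mul_rpow (by positivity) (by positivity),
        div_mul_div_cancel₀ hS0.ne', div_self hwpos.ne', Real.one_rpow, mul_one]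
      exact half_lt_self hε)
  refine ⟨h, fun n => ?_⟩
  have h1 : (frob Fq C ^ (n + 1)) ((frob Fq C ^ (-1 : ℤ)) w) = (frob Fq C ^ n) w := by
    rw [← frob_zpow_add_apply, add_neg_cancel_right]
  simp only [hh, map_div₀, h1]
  rw [hTs n]
  have := hw0 n
  have := hw0 (n + 1)
  field_simp
  simp [hx]

theorem IsRightFactor.toLinearMap_apply {f h : FSeries Fq C} {b : C} (hfh : IsRightFactor f h b)
    (z : C) : f.toLinearMap z = h.toLinearMap (z - b * (frob Fq C ^ (-1 : ℤ)) z) := by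
  rw [map_sub]
  have h1 := (Equiv.addRight (1 : ℤ)).tsum_eq
    fun n => h.coeff n * (frob Fq C ^ n) (b * (frob Fq C ^ (-1 : ℤ)) z)
  have h2 := (Equiv.addRight (1 : ℤ)).summable_iff.mpr
    (h.summable (b * (frob Fq C ^ (-1 : ℤ)) z))
  simp only [FSeries.toLinearMap_apply]
  refine Eq.trans ?_ (congrArg _ h1)
  refine Eq.trans ?_ ((h.summable z).tsum_sub h2)
  refine tsum_congr fun n => ?_
  simp only [Equiv.coe_addRight]
  rw [map_mul, ← frob_zpow_add_apply, add_neg_cancel_right, hfh n]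
  ring

/-- Induction on the growth of the top index of `f`: if it is positive, `f` has a zero `w` between
the radii, and dividing `f` and `h` by the linear factor that kills `w` lowers both growths by
one. -/
theorem isTop_sub_le_aux (k : ℕ) : ∀ (f h : FSeries Fq C) (ρ R : ℝ) (m n m' n' : ℤ),
    f.ker ≤ h.ker → 0 < ρ → ρ ≤ R → f.IsTop ρ m → f.IsTop R n → h.IsTop ρ m' → h.IsTop R n' →
      n - m = k → n - m ≤ n' - m' := by
  induction k with
  | zero =>
    intro f h ρ R m n m' n' _ hρ hρR _ _ hm' hn' hk
    have := hm'.mono hρ hρR hn'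
    omega
  | succ k ih =>
    intro f h ρ R m n m' n' hker hρ hρR hm hn hm' hn' hk
    have hR := hρ.trans_le hρR
    obtain ⟨w, hwf, hρw, hwR⟩ := exists_mem_ker_of_isTop_lt hρ hρR hm hn (by omega)
    have hwpos := hρ.trans hρw
    have hw : w ≠ 0 := norm_pos_iff.mp hwpos
    obtain ⟨f', hf'⟩ := f.exists_isRightFactor hw hwf
    obtain ⟨h', hh'⟩ := h.exists_isRightFactor hw (hker hwf)
    have hq := one_lt_card_real Fq
    set b := w / (frob Fq C ^ (-1 : ℤ)) w with hb
    set ρ' := ‖b‖ * ρ ^ ((Fintype.card Fq : ℝ)⁻¹) with hρ'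
    have hρ'w : ρ' ≤ ‖w‖ := by
      rw [hρ', norm_div_frob_mul_rpow w hρ]
      refine mul_le_of_le_one_right hwpos.le (Real.rpow_le_one (by positivity) ?_ (by positivity))
      exact (div_le_one hwpos).mpr hρw.le
    have hρρ' : ρ < ρ' := by
      rw [hρ', norm_div_frob_mul_rpow w hρ, mul_comm, ← div_lt_iff₀ hwpos]
      conv_lhs => rw [← Real.rpow_one (ρ / ‖w‖)]
      exact Real.rpow_lt_rpow_of_exponent_gt (by positivity) ((div_lt_one hwpos).mpr hρw)
        (inv_lt_one_of_one_lt₀ hq)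
    have hRb : ‖b‖ * R ^ ((Fintype.card Fq : ℝ)⁻¹) ≤ R := by
      rw [norm_div_frob_mul_rpow w hR, mul_comm, ← le_div_iff₀ hwpos]
      conv_rhs => rw [← Real.rpow_one (R / ‖w‖)]
      exact Real.rpow_le_rpow_of_exponent_le ((one_le_div hwpos).mpr hwR)
        (inv_lt_one_of_one_lt₀ hq).le
    have hne : ∀ {F F' : FSeries Fq C}, IsRightFactor F F' b → F ≠ 0 → F' ≠ 0 := by
      rintro F F' hF h0 rfl
      exact h0 (FSeries.ext (funext fun n => by simp [hF n]))
    have hρ'0 := hρ.trans hρρ'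
    have hf'0 := hne hf' (hm.ne_zero hρ.le)
    have hh'0 := hne hh' (hm'.ne_zero hρ.le)
    obtain ⟨i, hi⟩ := exists_isTop hf'0 hρ'0
    obtain ⟨j, hj⟩ := exists_isTop hf'0 hR
    obtain ⟨i', hi'⟩ := exists_isTop hh'0 hρ'0
    obtain ⟨j', hj'⟩ := exists_isTop hh'0 hR
    have e1 := (hf'.isTop_of_lt hρ hρρ' hi).unique hm
    have e2 := (hf'.isTop_of_le hR hRb hj).unique hn
    have e3 := (hh'.isTop_of_lt hρ hρρ' hi').unique hm'
    have e4 := (hh'.isTop_of_le hR hRb hj').unique hn'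
    have hker' : f'.ker ≤ h'.ker := by
      intro x hx
      obtain ⟨z, rfl⟩ := exists_sub_mul_frob_eq Fq b x
      rw [mem_ker, ← hf'.toLinearMap_apply] at hx
      rw [mem_ker, ← hh'.toLinearMap_apply]
      exact hker hx
    have := ih f' h' ρ' R i j i' j' hker' hρ'0 (hρ'w.trans hwR) hi hj hi' hj' (by omega)
    omega

/-- The top index grows at least as fast for a series with a larger kernel: between the radii `ρ`
and `R` it grows by the `𝔽_q`-dimension of the part of the kernel of size at most `R` modulo that
of size at most `ρ`. -/
theorem isTop_sub_le {f h : FSeries Fq C} (hker : f.ker ≤ h.ker) {ρ R : ℝ} (hρ : 0 < ρ)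
    (hρR : ρ ≤ R) {m n m' n' : ℤ} (hm : f.IsTop ρ m) (hn : f.IsTop R n) (hm' : h.IsTop ρ m')
    (hn' : h.IsTop R n') : n - m ≤ n' - m' :=
  isTop_sub_le_aux (n - m).toNat f h ρ R m n m' n' hker hρ hρR hm hn hm' hn'
    (Int.toNat_of_nonneg (sub_nonneg.mpr (hm.mono hρ hρR hn))).symm

end FSeries

/-! ### A series is determined by its kernel -/

/-- Comparison of two functions with increments controlled by `D` from above and by `E` from below:
halving the interval repeatedly shows that `κ D ≤ E` gives `κ Δφ ≤ Δψ`. -/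
theorem mul_sub_le_sub_of_slope_le {φ ψ D E : ℝ → ℝ} {κ a b : ℝ} (hκ : 0 ≤ κ) (hab : a ≤ b)
    (hφ : ∀ s t, a ≤ s → s ≤ t → t ≤ b → φ t - φ s ≤ D t * (t - s))
    (hψ : ∀ s t, a ≤ s → s ≤ t → t ≤ b → E s * (t - s) ≤ ψ t - ψ s)
    (hDE : ∀ t, a ≤ t → t ≤ b → κ * D t ≤ E t) : κ * (φ b - φ a) ≤ ψ b - ψ a := by
  have key : ∀ (n : ℕ) (s t : ℝ), a ≤ s → s ≤ t → t ≤ b →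
      κ * (φ t - φ s) - (ψ t - ψ s) ≤ (E t - E s) * (t - s) / 2 ^ n := by
    intro n
    induction n with
    | zero =>
      intro s t hs hst ht
      have h1 := mul_le_mul_of_nonneg_left (hφ s t hs hst ht) hκ
      have h2 := hψ s t hs hst ht
      have h3 := mul_le_mul_of_nonneg_right (hDE t (hs.trans hst) ht) (sub_nonneg.mpr hst)
      rw [pow_zero, div_one]
      linarith
    | succ n ih =>
      intro s t hs hst ht
      have h1 := ih s ((s + t) / 2) hs (by linarith) (by linarith)
      have h2 := ih ((s + t) / 2) t (by linarith) (by linarith) ht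
      have h3 : (E t - E s) * (t - s) / 2 ^ (n + 1) =
          (E ((s + t) / 2) - E s) * ((s + t) / 2 - s) / 2 ^ n +
            (E t - E ((s + t) / 2)) * (t - (s + t) / 2) / 2 ^ n := by
        rw [pow_succ]; field_simp; ring
      rw [h3]
      linarith
  have hlim : Tendsto (fun n : ℕ => (E b - E a) * (b - a) / 2 ^ n) atTop (𝓝 0) := by
    have := (tendsto_pow_atTop_nhds_zero_of_lt_one (r := (1 / 2 : ℝ)) (by norm_num)
      (by norm_num)).const_mul ((E b - E a) * (b - a))
    simpa [div_eq_mul_inv] using this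
  have := ge_of_tendsto' hlim fun n => key n a b le_rfl hab le_rfl
  linarith

namespace FSeries

section

variable {Fq C : Type*} [Field Fq] [Fintype Fq] [NormedField C] [IsAlgClosed C] [Algebra Fq C]

/-- The largest index at which `|f|_R` is attained (for `f ≠ 0` and `R > 0`). -/
noncomputable def topIndex (f : FSeries Fq C) (R : ℝ) : ℤ := Classical.epsilon (f.IsTop R)

theorem isTop_topIndex {f : FSeries Fq C} (hf : f ≠ 0) {R : ℝ} (hR : 0 < R) :
    f.IsTop R (f.topIndex R) :=
  Classical.epsilon_spec (exists_isTop hf hR)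

theorem IsTop.topIndex_eq {f : FSeries Fq C} {R : ℝ} {n : ℤ} (h : f.IsTop R n) :
    f.topIndex R = n :=
  (Classical.epsilon_spec (⟨n, h⟩ : ∃ n, f.IsTop R n)).unique h

theorem termNorm_exp (f : FSeries Fq C) (s t : ℝ) (n : ℤ) :
    f.termNorm (Real.exp t) n =
      f.termNorm (Real.exp s) n * Real.exp ((Fintype.card Fq : ℝ) ^ n * (t - s)) := by
  rw [termNorm, termNorm, ← Real.exp_mul, ← Real.exp_mul, mul_assoc, ← Real.exp_add]
  ring_nf

/-- `log |f|_R` has slope at most `q^N(t)` in `log R` to the left of `t`. -/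
theorem log_gaussNorm_sub_le {f : FSeries Fq C} (hf : f ≠ 0) (s t : ℝ) :
    Real.log (f.gaussNorm (Real.exp t)) - Real.log (f.gaussNorm (Real.exp s)) ≤
      (Fintype.card Fq : ℝ) ^ f.topIndex (Real.exp t) * (t - s) := by
  have ht := Real.exp_pos t
  have hs := Real.exp_pos s
  have htop := isTop_topIndex hf ht
  have h1 : f.gaussNorm (Real.exp t) ≤ f.gaussNorm (Real.exp s) *
      Real.exp ((Fintype.card Fq : ℝ) ^ f.topIndex (Real.exp t) * (t - s)) := by
    rw [htop.gaussNorm_eq ht.le, termNorm_exp f s t]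
    exact mul_le_mul_of_nonneg_right (f.termNorm_le_gaussNorm hs.le _) (Real.exp_pos _).le
  have h2 := Real.log_le_log (gaussNorm_pos hf ht) h1
  rw [Real.log_mul (gaussNorm_pos hf hs).ne' (Real.exp_pos _).ne', Real.log_exp] at h2
  linarith

theorem le_log_gaussNorm_sub {f : FSeries Fq C} (hf : f ≠ 0) (s t : ℝ) :
    (Fintype.card Fq : ℝ) ^ f.topIndex (Real.exp s) * (t - s) ≤
      Real.log (f.gaussNorm (Real.exp t)) - Real.log (f.gaussNorm (Real.exp s)) := by
  have := log_gaussNorm_sub_le hf t s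
  linarith

end

variable {Fq C : Type*} [Field Fq] [Fintype Fq] [NormedField C] [IsAlgClosed C] [Algebra Fq C]
  [IsUltrametricDist C]

theorem coeff_monomial_comp (ε : C) (k : ℤ) (f : FSeries Fq C) (n : ℤ) :
    ((monomial ε k).comp f).coeff n = ε * (frob Fq C ^ k) (f.coeff (n - k)) := by
  change ∑' i : ℤ, (Pi.single k ε : ℤ → C) i * (frob Fq C ^ i) (f.coeff (n - i)) = _
  rw [tsum_eq_single k fun i hi => by rw [Pi.single_eq_of_ne hi, zero_mul], Pi.single_eq_same]

theorem termNorm_monomial_comp (ε : C) (k : ℤ) (f : FSeries Fq C) {R : ℝ} (hR : 0 ≤ R) (n : ℤ) :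
    ((monomial ε k).comp f).termNorm R n =
      ‖ε‖ * f.termNorm R (n - k) ^ ((Fintype.card Fq : ℝ) ^ k) := by
  have hq : (Fintype.card Fq : ℝ) ≠ 0 := by positivity
  rw [termNorm, coeff_monomial_comp, norm_mul, norm_frob_zpow_apply, termNorm,
    Real.mul_rpow (norm_nonneg _) (by positivity), ← Real.rpow_mul hR, ← zpow_add₀ hq,
    sub_add_cancel, mul_assoc]

theorem isTop_monomial_comp {ε : C} (hε : ε ≠ 0) (k : ℤ) {f : FSeries Fq C} {R : ℝ} (hR : 0 ≤ R)
    {n : ℤ} (hn : f.IsTop R n) : ((monomial ε k).comp f).IsTop R (n + k) := by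
  refine ⟨fun m => ?_, fun m hm => ?_⟩ <;>
    rw [termNorm_monomial_comp ε k f hR, termNorm_monomial_comp ε k f hR, add_sub_cancel_right]
  · exact mul_le_mul_of_nonneg_left (Real.rpow_le_rpow (f.termNorm_nonneg hR _) (hn.le _)
      (card_zpow_pos Fq k).le) (norm_nonneg _)
  · exact mul_lt_mul_of_pos_left (Real.rpow_lt_rpow (f.termNorm_nonneg hR _) (hn.lt _ (by omega))
      (card_zpow_pos Fq k)) (norm_pos_iff.mpr hε)

theorem isUnit_monomial {ε : C} (hε : ε ≠ 0) (k : ℤ) : (monomial ε k : FSeries Fq C).IsUnit := by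
  have key : ∀ (a b : C) (m : ℤ), a * (frob Fq C ^ m) b = 1 →
      (monomial a m : FSeries Fq C).comp (monomial b (-m)) = one := by
    intro a b m hab
    refine FSeries.ext (funext fun n => ?_)
    rw [coeff_monomial_comp]
    change a * (frob Fq C ^ m) ((Pi.single (-m) b : ℤ → C) (n - m)) = (Pi.single 0 1 : ℤ → C) n
    rcases eq_or_ne n 0 with rfl | hn
    · rw [zero_sub, Pi.single_eq_same, Pi.single_eq_same, hab]
    · rw [Pi.single_eq_of_ne (by omega), Pi.single_eq_of_ne hn, map_zero, mul_zero]
  refine ⟨monomial ((frob Fq C ^ (-k)) ε⁻¹) (-k), key _ _ _ ?_, ?_⟩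
  · rw [← frob_zpow_add_apply, add_neg_cancel, zpow_zero, AlgEquiv.one_apply, mul_inv_cancel₀ hε]
  · have := key ((frob Fq C ^ (-k)) ε⁻¹) ε (-k) (by
      rw [← map_mul, inv_mul_cancel₀ hε, map_one])
    rwa [neg_neg] at this

theorem continuous_frob_zpow (k : ℤ) : Continuous (frob Fq C ^ k) := by
  refine continuous_of_continuousAt_zero (frob Fq C ^ k : C ≃ₐ[Fq] C).toAddMonoidHom ?_
  have := tendsto_frob_zpow_zero (Fq := Fq) (C := C) k
  simpa [ContinuousAt] using this

variable [CompleteSpace C]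

theorem toLinearMap_monomial_comp (ε : C) (k : ℤ) (f : FSeries Fq C) (z : C) :
    ((monomial ε k).comp f).toLinearMap z = ε * (frob Fq C ^ k) (f.toLinearMap z) := by
  have h1 := (f.summable z).map_tsum (frob Fq C ^ k : C ≃ₐ[Fq] C) (continuous_frob_zpow k)
  simp only [toLinearMap_apply, coeff_monomial_comp]
  rw [h1, ← tsum_mul_left, ← (Equiv.addRight k).tsum_eq]
  refine tsum_congr fun n => ?_
  rw [Equiv.coe_addRight]
  beta_reduce
  rw [add_sub_cancel_right, map_mul, ← frob_zpow_add_apply, add_comm n k, mul_assoc]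

theorem ker_monomial_comp {ε : C} (hε : ε ≠ 0) (k : ℤ) (f : FSeries Fq C) :
    ((monomial ε k).comp f).ker = f.ker := by
  ext z
  rw [mem_ker, mem_ker, toLinearMap_monomial_comp, mul_eq_zero, or_iff_right hε,
    map_eq_zero_iff _ (AlgEquiv.injective _)]

/-- For series with the same kernel, the difference of the top indices does not depend on the
radius. -/
theorem topIndex_sub_topIndex_eq {f g : FSeries Fq C} (hf : f ≠ 0) (hg : g ≠ 0)
    (hker : f.ker = g.ker) {R : ℝ} (hR : 0 < R) :
    f.topIndex R - g.topIndex R = f.topIndex 1 - g.topIndex 1 := by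
  have h1 := one_pos (α := ℝ)
  have key : ∀ {f g : FSeries Fq C}, f ≠ 0 → g ≠ 0 → f.ker = g.ker →
      f.topIndex R - g.topIndex R ≤ f.topIndex 1 - g.topIndex 1 := by
    intro f g hf hg hker
    rcases le_total R 1 with h | h
    · have := isTop_sub_le hker.ge hR h (isTop_topIndex hg hR) (isTop_topIndex hg h1)
        (isTop_topIndex hf hR) (isTop_topIndex hf h1)
      omega
    · have := isTop_sub_le hker.le h1 h (isTop_topIndex hf h1) (isTop_topIndex hf hR)
        (isTop_topIndex hg h1) (isTop_topIndex hg hR)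
      omega
  have := key hf hg hker
  have := key hg hf hker.symm
  omega

/-- If `f - g` were nonzero, its top index would stay above that of `f` at all large radii or
below it at all small radii, because its kernel contains that of `f`. As `|f - g|_R ≤ |f|_R` for
all `R`, the first is excluded by growth as `R → ∞` and the second by decay as `R → 0`. -/
theorem eq_of_ker_eq_of_coeff_eq {f g : FSeries Fq C} (hf : f ≠ 0) (hg : g ≠ 0)
    (hker : f.ker = g.ker) (htop : f.topIndex 1 = g.topIndex 1)
    (hcoeff : f.coeff (f.topIndex 1) = g.coeff (f.topIndex 1)) : f = g := by
  have hN : ∀ R : ℝ, 0 < R → f.topIndex R = g.topIndex R := fun R hR => by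
    have := topIndex_sub_topIndex_eq hf hg hker hR
    omega
  set q : ℝ := (Fintype.card Fq : ℝ) with hq
  have hq1 : 1 < q := one_lt_card_real Fq
  set L : FSeries Fq C → ℝ → ℝ := fun f t => Real.log (f.gaussNorm (Real.exp t)) with hL
  have hLfg : ∀ t, L f t = L g t := by
    have key : ∀ {f g : FSeries Fq C}, f ≠ 0 → g ≠ 0 →
        (∀ R : ℝ, 0 < R → f.topIndex R = g.topIndex R) → ∀ a b : ℝ, a ≤ b →
        L f b - L f a ≤ L g b - L g a := by
      intro f g hf hg hN a b hab
      have := mul_sub_le_sub_of_slope_le (φ := L f) (ψ := L g)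
        (D := fun t => q ^ f.topIndex (Real.exp t)) (E := fun t => q ^ g.topIndex (Real.exp t))
        (κ := 1) zero_le_one hab (fun s t _ _ _ => log_gaussNorm_sub_le hf s t)
        (fun s t _ _ _ => le_log_gaussNorm_sub hg s t)
        (fun t _ _ => by simp only [hN _ (Real.exp_pos t), one_mul, le_refl])
      simpa using this
    have h0 : L f 0 = L g 0 := by
      simp only [hL, Real.exp_zero]
      rw [(isTop_topIndex hf one_pos).gaussNorm_eq zero_le_one,
        (isTop_topIndex hg one_pos).gaussNorm_eq zero_le_one, ← htop, termNorm, termNorm, hcoeff]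
    have hN' : ∀ R : ℝ, 0 < R → g.topIndex R = f.topIndex R := fun R hR => (hN R hR).symm
    intro t
    rcases le_total 0 t with ht | ht
    · have h1 := key hf hg hN 0 t ht
      have h2 := key hg hf hN' 0 t ht
      linarith
    · have h1 := key hf hg hN t 0 ht
      have h2 := key hg hf hN' t 0 ht
      linarith
  by_contra hne
  have hh : f - g ≠ 0 := by
    intro h
    refine hne (FSeries.ext (funext fun n => ?_))
    have := congrArg (fun F => coeff F n) h
    simpa [sub_eq_zero] using this
  set h := f - g with hdef
  have hhker : f.ker ≤ h.ker := by
    intro z hz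
    have hz' : z ∈ g.ker := hker ▸ hz
    rw [mem_ker] at hz hz' ⊢
    rw [hdef, toLinearMap_sub, hz, hz', sub_zero]
  have hhL : ∀ t, L h t ≤ L f t := by
    intro t
    have ht := Real.exp_pos t
    have hfg : f.gaussNorm (Real.exp t) = g.gaussNorm (Real.exp t) :=
      Real.log_injOn_pos (gaussNorm_pos hf ht) (gaussNorm_pos hg ht) (hLfg t)
    refine Real.log_le_log (gaussNorm_pos hh ht) ?_
    have := gaussNorm_sub_le f g ht.le
    rwa [← hfg, max_self] at this
  have hne1 : h.topIndex 1 ≠ f.topIndex 1 := by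
    intro he
    have h1 := (isTop_topIndex hh one_pos).coeff_ne_zero zero_le_one
    rw [he, hdef, coeff_sub, hcoeff, sub_self] at h1
    exact h1 rfl
  have hqpow : ∀ m n : ℤ, m + 1 ≤ n → q * q ^ m ≤ q ^ n := by
    intro m n hmn
    rw [← zpow_one_add₀ (by positivity)]
    exact card_zpow_le Fq (by omega)
  rcases lt_or_gt_of_ne hne1 with hlt | hgt
  · have h1 : ∀ t : ℝ, t ≤ 0 → q * (L h 0 - L h t) ≤ L f 0 - L f t := by
      intro t ht
      refine mul_sub_le_sub_of_slope_le (D := fun t => q ^ h.topIndex (Real.exp t))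
        (E := fun t => q ^ f.topIndex (Real.exp t)) (zero_lt_one.trans hq1).le ht
        (fun s t _ _ _ => log_gaussNorm_sub_le hh s t)
        (fun s t _ _ _ => le_log_gaussNorm_sub hf s t) (fun s _ hs => hqpow _ _ ?_)
      have hs' := Real.exp_pos s
      have hs1 : Real.exp s ≤ 1 := Real.exp_le_one_iff.mpr hs
      have := isTop_sub_le hhker hs' hs1 (isTop_topIndex hf hs') (isTop_topIndex hf one_pos)
        (isTop_topIndex hh hs') (isTop_topIndex hh one_pos)
      omega
    -- hence `log |h|_R` is bounded below as `R → 0`, which contradicts `|f|_R → 0`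
    obtain ⟨B, hB⟩ : ∃ B : ℝ, ∀ t ≤ 0, B ≤ L f t := by
      refine ⟨(q * L h 0 - L f 0) / (q - 1), fun t ht => ?_⟩
      rw [div_le_iff₀ (by linarith)]
      have h2 := h1 t ht
      have h3 := mul_le_mul_of_nonneg_left (hhL t) (zero_lt_one.trans hq1).le
      linarith
    obtain ⟨δ, hδ, hsmall⟩ := f.exists_forall_gaussNorm_le (Real.exp_pos (B - 1))
    set t := min 0 (Real.log δ) with ht
    have h2 := hsmall (Real.exp t) (Real.exp_pos t).le (by
      rw [← Real.exp_log hδ]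
      exact Real.exp_le_exp.mpr (min_le_right _ _))
    have h3 := Real.log_le_log (gaussNorm_pos hf (Real.exp_pos t)) h2
    rw [Real.log_exp] at h3
    have h4 := hB t (min_le_left _ _)
    simp only [hL] at h4
    linarith
  · have h1 : ∀ t : ℝ, 0 ≤ t → q * (L f t - L f 0) ≤ L h t - L h 0 := by
      intro t ht
      refine mul_sub_le_sub_of_slope_le (D := fun t => q ^ f.topIndex (Real.exp t))
        (E := fun t => q ^ h.topIndex (Real.exp t)) (zero_lt_one.trans hq1).le ht
        (fun s t _ _ _ => log_gaussNorm_sub_le hf s t)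
        (fun s t _ _ _ => le_log_gaussNorm_sub hh s t) (fun s hs _ => hqpow _ _ ?_)
      have hs' := Real.exp_pos s
      have hs1 : 1 ≤ Real.exp s := Real.one_le_exp hs
      have := isTop_sub_le hhker one_pos hs1 (isTop_topIndex hf one_pos) (isTop_topIndex hf hs')
        (isTop_topIndex hh one_pos) (isTop_topIndex hh hs')
      omega
    -- hence `log |f|_R` is bounded above as `R → ∞`
    obtain ⟨B, hB⟩ : ∃ B : ℝ, ∀ t, 0 ≤ t → L f t ≤ B := by
      refine ⟨(q * L f 0 - L h 0) / (q - 1), fun t ht => ?_⟩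
      rw [le_div_iff₀ (by linarith)]
      have h2 := h1 t ht
      have h3 := hhL t
      linarith
    have hslope := fun t => le_log_gaussNorm_sub hf 0 t
    have hD := card_zpow_pos Fq (f.topIndex (Real.exp 0))
    set D := (Fintype.card Fq : ℝ) ^ f.topIndex (Real.exp 0) with hDdef
    have hB0 := hB 0 le_rfl
    have ht0 : 0 ≤ (B - L f 0 + 1) / D := div_nonneg (by linarith) hD.le
    have h2 := hslope ((B - L f 0 + 1) / D)
    have h3 := hB _ ht0
    rw [sub_zero, mul_div_cancel₀ _ hD.ne'] at h2
    simp only [hL] at h2 h3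
    linarith

theorem exists_eq_monomial_comp {f g : FSeries Fq C} (hf : f ≠ 0) (hg : g ≠ 0)
    (hker : f.ker = g.ker) : ∃ (ε : C) (n : ℤ), ε ≠ 0 ∧ g = (monomial ε n).comp f := by
  have hf1 := isTop_topIndex hf one_pos
  have hg1 := isTop_topIndex hg one_pos
  set k := g.topIndex 1 - f.topIndex 1 with hk
  have ha : (frob Fq C ^ k) (f.coeff (f.topIndex 1)) ≠ 0 := by
    rw [Ne, map_eq_zero_iff _ (AlgEquiv.injective _)]
    exact hf1.coeff_ne_zero zero_le_one
  set ε := g.coeff (g.topIndex 1) / (frob Fq C ^ k) (f.coeff (f.topIndex 1)) with hε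
  have hε0 : ε ≠ 0 := div_ne_zero (hg1.coeff_ne_zero zero_le_one) ha
  have htop := isTop_monomial_comp hε0 k zero_le_one hf1
  have hidx : f.topIndex 1 + k = g.topIndex 1 := by omega
  rw [hidx] at htop
  refine ⟨ε, k, hε0, eq_of_ker_eq_of_coeff_eq hg (htop.ne_zero zero_le_one) ?_ ?_ ?_⟩
  · rw [ker_monomial_comp hε0, hker]
  · exact htop.topIndex_eq.symm
  · rw [coeff_monomial_comp, show g.topIndex 1 - k = f.topIndex 1 by omega, hε,
      div_mul_cancel₀ _ ha]

/-- A nonzero series is surjective. -/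
theorem ker_ne_top {f : FSeries Fq C} (hf : f ≠ 0) : f.ker ≠ ⊤ := by
  intro h
  obtain ⟨R, hR, h1⟩ : ∃ R : ℝ, 0 < R ∧ 1 ≤ f.gaussNorm R := by
    obtain ⟨n, hn⟩ := exists_coeff_ne_zero hf
    have hn' := norm_pos_iff.mpr hn
    have hq := card_zpow_pos Fq n
    refine ⟨(‖f.coeff n‖⁻¹) ^ (((Fintype.card Fq : ℝ) ^ n)⁻¹), by positivity, ?_⟩
    refine le_trans (le_of_eq ?_) (f.termNorm_le_gaussNorm (by positivity) n)
    rw [termNorm, ← Real.rpow_mul (by positivity), inv_mul_cancel₀ hq.ne', Real.rpow_one,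
      mul_inv_cancel₀ hn'.ne']
  obtain ⟨z, -, hz⟩ := f.exists_toLinearMap_eq hR (y := 1) (by rwa [norm_one])
  have hz0 : z ∈ f.ker := h ▸ Submodule.mem_top
  rw [mem_ker, hz] at hz0
  exact one_ne_zero hz0

end FSeries

/-! ### Logarithmic averages over a compact subgroup -/

section Average

variable (Fq : Type*) {C : Type*} [Field Fq] [Fintype Fq] [NormedField C] [Algebra Fq C]

theorem norm_algebraMap_eq_one {c : Fq} (hc : c ≠ 0) : ‖algebraMap Fq C c‖ = 1 := by
  have h1 : algebraMap Fq C c ^ (Fintype.card Fq - 1) = 1 := by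
    rw [← map_pow, FiniteField.pow_card_sub_one_eq_one c hc, map_one]
  have h2 : ‖algebraMap Fq C c‖ ^ (Fintype.card Fq - 1) = 1 := by
    rw [← norm_pow, h1, norm_one]
  exact (pow_eq_one_iff_of_nonneg (norm_nonneg _)
    (Nat.sub_pos_of_lt Fintype.one_lt_card).ne').mp h2

theorem norm_finiteField_smul_le (c : Fq) (z : C) : ‖c • z‖ ≤ ‖z‖ := by
  rcases eq_or_ne c 0 with rfl | hc
  · simp
  · rw [Algebra.smul_def, norm_mul, norm_algebraMap_eq_one Fq hc, one_mul]

theorem pow_card_sub_mul_eq_prod (x u : C) :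
    x ^ Fintype.card Fq - u ^ (Fintype.card Fq - 1) * x = ∏ c : Fq, (x - c • u) := by
  have hq : 1 < Fintype.card Fq := Fintype.one_lt_card
  rcases eq_or_ne u 0 with rfl | hu
  · simp [zero_pow (Nat.sub_pos_of_lt hq).ne']
  have h1 : (∏ c : Fq, (Polynomial.X - Polynomial.C c)) =
      (Polynomial.X ^ Fintype.card Fq - Polynomial.X : Polynomial Fq) := by
    have hm : (Polynomial.X ^ Fintype.card Fq - Polynomial.X : Polynomial Fq).Monic :=
      Polynomial.monic_X_pow_sub (by rw [Polynomial.degree_X]; exact_mod_cast hq)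
    have h2 := Polynomial.prod_multiset_X_sub_C_of_monic_of_roots_card_eq hm (by
      rw [FiniteField.roots_X_pow_card_sub_X, FiniteField.X_pow_card_sub_X_natDegree_eq Fq hq]
      rfl)
    rw [FiniteField.roots_X_pow_card_sub_X] at h2
    exact h2
  have h2 := congrArg (Polynomial.aeval (x / u)) h1
  simp only [map_prod, map_sub, map_pow, Polynomial.aeval_X, Polynomial.aeval_C] at h2
  have h3 : ∏ c : Fq, (x - c • u) =
      u ^ Fintype.card Fq * ∏ c : Fq, (x / u - algebraMap Fq C c) := by
    rw [← Finset.card_univ, ← Finset.prod_const, ← Finset.prod_mul_distrib]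
    refine Finset.prod_congr rfl fun c _ => ?_
    rw [Algebra.smul_def]
    field_simp
  have h4 : u ^ Fintype.card Fq = u ^ (Fintype.card Fq - 1) * u := by
    rw [← pow_succ, Nat.sub_add_cancel hq.le]
  rw [h3, h2, mul_sub, ← mul_pow, mul_div_cancel₀ _ hu, h4, mul_assoc, mul_div_cancel₀ _ hu]

/-- The average of `log max(|z - w|, ρ)` over the linear combinations `w` of the first `i` terms of
the sequence `w`, with all `q ^ i` choices of coefficients counted. -/
noncomputable def avgLog (w : ℕ → C) (ρ : ℝ) : ℕ → C → ℝ
  | 0, z => Real.log (max ‖z‖ ρ)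
  | i + 1, z => (∑ c : Fq, avgLog w ρ i (z - c • w i)) / Fintype.card Fq

variable {Fq}

theorem continuous_avgLog (w : ℕ → C) {ρ : ℝ} (hρ : 0 < ρ) (i : ℕ) :
    Continuous (avgLog Fq w ρ i) := by
  induction i with
  | zero =>
    refine Continuous.log (by fun_prop) fun z => ?_
    exact (hρ.trans_le (le_max_right _ _)).ne'
  | succ i ih =>
    refine Continuous.div_const (continuous_finsetSum _ fun c _ => ?_) _
    exact ih.comp (continuous_id.sub continuous_const)

theorem avgLog_add_of_norm_le [IsUltrametricDist C] (w : ℕ → C) {ρ : ℝ} (i : ℕ) {h : C}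
    (hh : ‖h‖ ≤ ρ) (z : C) : avgLog Fq w ρ i (z + h) = avgLog Fq w ρ i z := by
  induction i generalizing z with
  | zero =>
    have key : ∀ z h : C, ‖h‖ ≤ ρ → max ‖z + h‖ ρ ≤ max ‖z‖ ρ := fun z h hh =>
      max_le ((IsUltrametricDist.norm_add_le_max z h).trans (max_le_max le_rfl hh))
        (le_max_right _ _)
    have h1 := key z h hh
    have h2 := key (z + h) (-h) (by rwa [norm_neg])
    rw [add_neg_cancel_right] at h2
    rw [avgLog, avgLog, le_antisymm h1 h2]
  | succ i ih =>
    simp only [avgLog, add_sub_right_comm, ih]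

theorem avgLog_add_smul (w : ℕ → C) (ρ : ℝ) {i j : ℕ} (hj : j < i) (z : C) :
    avgLog Fq w ρ i (z + w j) = avgLog Fq w ρ i z := by
  induction i generalizing z with
  | zero => omega
  | succ i ih =>
    simp only [avgLog]
    congr 1
    by_cases hji : j = i
    · -- translation by `w i` permutes the summands
      subst hji
      refine Fintype.sum_equiv (Equiv.subRight (1 : Fq)) _ _ fun c => ?_
      rw [Equiv.subRight_apply, sub_smul, one_smul]
      congr 1
      ring
    · refine Finset.sum_congr rfl fun c _ => ?_
      rw [add_sub_right_comm, ih (by omega)]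

/-- If `w` is dense in the compact group `H`, the averages are eventually constant on `H`. -/
theorem exists_avgLog_eq [IsUltrametricDist C] {H : AddSubgroup C} (hH : IsCompact (H : Set C))
    {w : ℕ → H} (hw : DenseRange w) {ρ : ℝ} (hρ : 0 < ρ) :
    ∃ N, ∀ i ≥ N, ∀ z h : C, h ∈ H →
      avgLog Fq (fun n => (w n : C)) ρ i (z + h) = avgLog Fq (fun n => (w n : C)) ρ i z := by
  have hcover : (H : Set C) ⊆ ⋃ n, Metric.ball (w n : C) ρ := by
    intro h hh
    obtain ⟨n, hn⟩ := hw.exists_dist_lt (⟨h, hh⟩ : H) hρ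
    exact Set.mem_iUnion.mpr ⟨n, hn⟩
  obtain ⟨t, ht⟩ := hH.elim_finite_subcover _ (fun n => Metric.isOpen_ball) hcover
  obtain ⟨N, hN⟩ := t.bddAbove
  refine ⟨N + 1, fun i hi z h hh => ?_⟩
  have := ht hh
  simp only [Set.mem_iUnion] at this
  obtain ⟨n, hnt, hn⟩ := this
  have hn' : ‖h - w n‖ ≤ ρ := by
    rw [← dist_eq_norm]; exact (Metric.mem_ball.mp hn).le
  have hni : n < i := by have := hN hnt; omega
  rw [← avgLog_add_smul (Fq := Fq) (fun n => (w n : C)) ρ hni z,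
    ← avgLog_add_of_norm_le (Fq := Fq) (fun n => (w n : C)) i hn' (z + w n)]
  congr 1
  ring

section Integral

variable {H : AddSubgroup C} [CompactSpace H] [MeasurableSpace H] [BorelSpace H]

theorem integral_avgLog (hsmul : ∀ (c : Fq), ∀ z ∈ H, c • z ∈ H) (μ : Measure H)
    [μ.IsAddHaarMeasure] (w : ℕ → H) {ρ : ℝ} (hρ : 0 < ρ) (i : ℕ) :
    ∫ z : H, avgLog Fq (fun n => (w n : C)) ρ i z ∂μ = ∫ z : H, Real.log (max ‖(z : C)‖ ρ) ∂μ := by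
  have hint : ∀ (φ : H → ℝ), Continuous φ → Integrable φ μ := fun φ hφ =>
    hφ.integrable_of_hasCompactSupport (HasCompactSupport.of_compactSpace φ)
  induction i with
  | zero => rfl
  | succ i ih =>
    have hcont := continuous_avgLog (Fq := Fq) (fun n => (w n : C)) hρ i
    have hstep : ∀ c : Fq, ∫ z : H, avgLog Fq (fun n => (w n : C)) ρ i (z - c • (w i : C)) ∂μ =
        ∫ z : H, Real.log (max ‖(z : C)‖ ρ) ∂μ := by
      intro c
      rw [← ih]
      exact integral_sub_right_eq_self
        (fun z : H => avgLog Fq (fun n => (w n : C)) ρ i z) (⟨c • (w i : C), hsmul c _ (w i).2⟩ : H)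
    simp only [avgLog]
    rw [integral_div, integral_finsetSum _ fun c _ => hint _ (by fun_prop)]
    simp only [hstep]
    rw [Finset.sum_const, Finset.card_univ, nsmul_eq_mul, mul_div_cancel_left₀]
    exact_mod_cast Fintype.card_ne_zero

/-- If `∫ v = +∞`, the truncated integrals of `-v` tend to `-∞`. -/
theorem exists_integral_log_max_le (μ : Measure H) [μ.IsAddHaarMeasure]
    (hμ : erealIntegral μ (fun z : H => addVal (z : C)) = ⊤) {r : ℝ} (hr : ∀ z ∈ H, ‖z‖ ≤ r)
    (B : ℝ) : ∃ ρ : ℝ, 0 < ρ ∧ ∫ z : H, Real.log (max ‖(z : C)‖ ρ) ∂μ ≤ B := by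
  have hpos : ∫⁻ z : H, (addVal (z : C)).toENNReal ∂μ = ⊤ := by
    by_contra h
    rw [erealIntegral] at hμ
    have h1 : ((∫⁻ z : H, (addVal (z : C)).toENNReal ∂μ : ENNReal) : EReal) -
        ((∫⁻ z : H, (-addVal (z : C)).toENNReal ∂μ : ENNReal) : EReal) ≤
          ((∫⁻ z : H, (addVal (z : C)).toENNReal ∂μ : ENNReal) : EReal) := by
      conv_rhs => rw [← sub_zero ((∫⁻ z : H, (addVal (z : C)).toENNReal ∂μ : ENNReal) : EReal)]
      exact EReal.sub_le_sub le_rfl (EReal.coe_ennreal_nonneg _)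
    rw [hμ, top_le_iff, EReal.coe_ennreal_eq_top_iff] at h1
    exact h h1
  set ψ : ℕ → H → ℝ := fun n z => Real.log (max ‖(z : C)‖ (Real.exp (-n))) with hψ
  have hψc : ∀ n, Continuous (ψ n) := fun n =>
    Continuous.log (by fun_prop) fun z => ((Real.exp_pos _).trans_le (le_max_right _ _)).ne'
  have hint : ∀ (φ : H → ℝ), Continuous φ → Integrable φ μ := fun φ hφ =>
    hφ.integrable_of_hasCompactSupport (HasCompactSupport.of_compactSpace φ)
  have hlim : Tendsto (fun n => ∫⁻ z : H, ENNReal.ofReal (-ψ n z) ∂μ) atTop (𝓝 ⊤) := by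
    rw [← hpos]
    refine lintegral_tendsto_of_tendsto_of_monotone
      (fun n => (hψc n).neg.measurable.ennreal_ofReal.aemeasurable)
      (Eventually.of_forall fun z m n hmn => ?_) (Eventually.of_forall fun z => ?_)
    · refine ENNReal.ofReal_le_ofReal (neg_le_neg (Real.log_le_log
        ((Real.exp_pos _).trans_le (le_max_right _ _)) (max_le_max le_rfl ?_)))
      exact Real.exp_le_exp.mpr (neg_le_neg (by exact_mod_cast hmn))
    · by_cases hz : (z : C) = 0
      · have h1 : ∀ n : ℕ, -ψ n z = n := by
          intro n
          simp only [hψ, hz, norm_zero, max_eq_right (Real.exp_pos _).le, Real.log_exp, neg_neg]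
        simp only [h1, addVal, hz, if_true, EReal.toENNReal_top, ENNReal.ofReal_natCast]
        exact ENNReal.tendsto_nat_nhds_top
      · refine tendsto_nhds_of_eventually_eq ?_
        obtain ⟨N, hN⟩ := exists_nat_ge (-Real.log ‖(z : C)‖)
        filter_upwards [eventually_ge_atTop N] with n hn
        have h1 : Real.exp (-n) ≤ ‖(z : C)‖ := by
          rw [← Real.exp_log (norm_pos_iff.mpr hz)]
          refine Real.exp_le_exp.mpr ?_
          have : (N : ℝ) ≤ n := by exact_mod_cast hn
          linarith
        simp only [hψ, addVal, hz, if_false, max_eq_left h1, EReal.real_coe_toENNReal]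
  set L := Real.log (max r 1) with hL
  have hψL : ∀ n z, ψ n z ≤ L := fun n z =>
    Real.log_le_log ((Real.exp_pos _).trans_le (le_max_right _ _))
      (max_le_max (hr z z.2) (Real.exp_le_one_iff.mpr (by simp)))
  have hL0 : 0 ≤ L := Real.log_nonneg (le_max_right _ _)
  obtain ⟨n, hn⟩ := (hlim.eventually_const_le
    (ENNReal.ofReal_lt_top (r := L * μ.real Set.univ - B))).exists
  refine ⟨Real.exp (-n), Real.exp_pos _, ?_⟩
  have h1 : ENNReal.ofReal (L * μ.real Set.univ - B) ≤
      ENNReal.ofReal (∫ z : H, (L - ψ n z) ∂μ) := by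
    rw [ofReal_integral_eq_lintegral_ofReal (hint _ (by have := hψc n; fun_prop))
      (Eventually.of_forall fun z => sub_nonneg.mpr (hψL n z))]
    refine hn.trans (lintegral_mono fun z => ENNReal.ofReal_le_ofReal ?_)
    linarith
  rw [ENNReal.ofReal_le_ofReal_iff (integral_nonneg fun z => sub_nonneg.mpr (hψL n z)),
    integral_sub (integrable_const _) (hint _ (hψc n)), integral_const, smul_eq_mul] at h1
  change ∫ z, ψ n z ∂μ ≤ B
  linarith

end Integral

/-- If `∫_H v = +∞` and `w` is dense in `H`, the averages over the span of the first `i` terms tend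
to `-∞` uniformly on `H` when `ρ` is small enough and `i → ∞`. -/
theorem exists_avgLog_le [IsUltrametricDist C] {H : AddSubgroup C} (hH : IsCompact (H : Set C))
    (hsmul : ∀ (c : Fq), ∀ z ∈ H, c • z ∈ H) {r : ℝ} (hr : ∀ z ∈ H, ‖z‖ ≤ r)
    (hint : IntegralAddValEqTop H) {w : ℕ → H} (hw : DenseRange w) (B : ℝ) :
    ∃ ρ : ℝ, 0 < ρ ∧ ∃ N, ∀ i ≥ N, ∀ z ∈ H, avgLog Fq (fun n => (w n : C)) ρ i z ≤ B := by
  let : MeasurableSpace H := borel H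
  have : BorelSpace H := ⟨rfl⟩
  have : CompactSpace H := isCompact_iff_compactSpace.mp hH
  obtain ⟨μ, hμ, hval⟩ := hint
  have hμ0 : 0 < μ.real Set.univ := by
    rw [Measure.real, ENNReal.toReal_pos_iff]
    exact ⟨Measure.measure_univ_pos.mpr (NeZero.ne μ), measure_lt_top μ _⟩
  obtain ⟨ρ, hρ, hle⟩ := exists_integral_log_max_le μ hval hr (B * μ.real Set.univ)
  obtain ⟨N, hN⟩ := exists_avgLog_eq (Fq := Fq) hH hw hρ
  refine ⟨ρ, hρ, N, fun i hi z hz => ?_⟩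
  rw [← integral_avgLog hsmul μ w hρ i] at hle
  have hconst : ∀ x : H, avgLog Fq (fun n => (w n : C)) ρ i x =
      avgLog Fq (fun n => (w n : C)) ρ i z := by
    intro x
    have := hN i hi z (x - z) (H.sub_mem x.2 hz)
    rwa [add_sub_cancel] at this
  simp only [hconst] at hle
  rw [integral_const, smul_eq_mul, mul_comm] at hle
  exact le_of_mul_le_mul_right hle hμ0

end Average

/-! ### The series attached to a compact subspace -/

namespace FSeries

variable {Fq C : Type*} [Field Fq] [Fintype Fq] [NormedField C] [IsAlgClosed C] [Algebra Fq C]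
  [IsUltrametricDist C]

theorem gaussNorm_monomial_comp_le (ε : C) (k : ℤ) (f : FSeries Fq C) {R : ℝ} (hR : 0 ≤ R) :
    ((monomial ε k).comp f).gaussNorm R ≤
      ‖ε‖ * f.gaussNorm R ^ ((Fintype.card Fq : ℝ) ^ k) := by
  refine gaussNorm_le fun n => ?_
  rw [termNorm_monomial_comp ε k f hR]
  exact mul_le_mul_of_nonneg_left (Real.rpow_le_rpow (f.termNorm_nonneg hR _)
    (f.termNorm_le_gaussNorm hR _) (card_zpow_pos Fq k).le) (norm_nonneg _)

theorem gaussNorm_le_max (f g : FSeries Fq C) {R : ℝ} (hR : 0 ≤ R) :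
    g.gaussNorm R ≤ max ((g - f).gaussNorm R) (f.gaussNorm R) := by
  refine gaussNorm_le fun n => ?_
  refine le_trans ?_ (max_le_max ((g - f).termNorm_le_gaussNorm hR n)
    (f.termNorm_le_gaussNorm hR n))
  unfold termNorm
  rw [← max_mul_of_nonneg _ _ (by positivity)]
  refine mul_le_mul_of_nonneg_right ?_ (by positivity)
  simpa using IsUltrametricDist.norm_add_le_max (g.coeff n - f.coeff n) (f.coeff n)

variable [CompleteSpace C]

theorem toLinearMap_one (z : C) : (one : FSeries Fq C).toLinearMap z = z := by
  rw [toLinearMap_apply]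
  change ∑' n : ℤ, (Pi.single 0 1 : ℤ → C) n * (frob Fq C ^ n) z = z
  rw [tsum_eq_single 0 fun n hn => by rw [Pi.single_eq_of_ne hn, zero_mul]]
  simp

/-- The series `f_i = (1 - b_{i-1} τ⁻¹) ∘ ⋯ ∘ (1 - b_0 τ⁻¹)` whose kernel is spanned by
`w 0, …, w (i - 1)`: the choice `b_i^q = f_i(w_i)^(q-1)` makes `f_{i+1}` vanish at `w i`. -/
noncomputable def innerSeries (w : ℕ → C) : ℕ → FSeries Fq C
  | 0 => one
  | i + 1 => innerSeries w i - (monomial ((frob Fq C ^ (-1 : ℤ))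
      ((innerSeries w i).toLinearMap (w i) ^ (Fintype.card Fq - 1))) (-1)).comp (innerSeries w i)

theorem norm_innerSeries_succ_pow (w : ℕ → C) (i : ℕ) (z : C) :
    ‖(innerSeries (Fq := Fq) w (i + 1)).toLinearMap z‖ ^ Fintype.card Fq =
      ∏ c : Fq, ‖(innerSeries (Fq := Fq) w i).toLinearMap (z - c • w i)‖ := by
  have h1 : frob Fq C ((innerSeries (Fq := Fq) w (i + 1)).toLinearMap z) =
      ∏ c : Fq, (innerSeries (Fq := Fq) w i).toLinearMap (z - c • w i) := by
    rw [innerSeries, toLinearMap_sub, toLinearMap_monomial_comp, map_sub, map_mul,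
      frob_frob_neg_one, frob_frob_neg_one, frob_apply, pow_card_sub_mul_eq_prod]
    exact Finset.prod_congr rfl fun c _ => by rw [map_sub, map_smul]
  rw [← norm_pow, ← frob_apply, h1, norm_prod]

theorem norm_innerSeries_le_exp_avgLog (w : ℕ → C) {ρ : ℝ} (hρ : 0 < ρ) (i : ℕ) (z : C) :
    ‖(innerSeries (Fq := Fq) w i).toLinearMap z‖ ≤ Real.exp (avgLog Fq w ρ i z) := by
  induction i generalizing z with
  | zero =>
    rw [avgLog, Real.exp_log (hρ.trans_le (le_max_right _ _)), innerSeries, toLinearMap_one]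
    exact le_max_left _ _
  | succ i ih =>
    rw [← pow_le_pow_iff_left₀ (norm_nonneg _) (Real.exp_pos _).le
      (Fintype.card_ne_zero (α := Fq)), norm_innerSeries_succ_pow, ← Real.exp_nat_mul, avgLog,
      mul_div_cancel₀ _ (by positivity), Real.exp_sum]
    exact Finset.prod_le_prod (fun _ _ => norm_nonneg _) fun c _ => ih _

theorem le_norm_innerSeries {H : AddSubgroup C} (hsmul : ∀ (c : Fq), ∀ z ∈ H, c • z ∈ H)
    {w : ℕ → C} (hw : ∀ i, w i ∈ H) {δ : ℝ} (hδ : 0 ≤ δ) (i : ℕ) {z : C}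
    (hz : ∀ h ∈ H, δ ≤ ‖z - h‖) : δ ≤ ‖(innerSeries (Fq := Fq) w i).toLinearMap z‖ := by
  induction i generalizing z with
  | zero =>
    rw [innerSeries, toLinearMap_one]
    simpa using hz 0 H.zero_mem
  | succ i ih =>
    rw [← pow_le_pow_iff_left₀ hδ (norm_nonneg _) (Fintype.card_ne_zero (α := Fq)),
      norm_innerSeries_succ_pow, ← Finset.card_univ, ← Finset.prod_const]
    refine Finset.prod_le_prod (fun _ _ => hδ) fun c _ => ih fun h hh => ?_
    rw [sub_sub]
    exact hz _ (H.add_mem (hsmul c _ (hw i)) hh)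

theorem innerSeries_apply_eq_zero (w : ℕ → C) {i j : ℕ} (hj : j < i) :
    (innerSeries (Fq := Fq) w i).toLinearMap (w j) = 0 := by
  induction i with
  | zero => omega
  | succ i ih =>
    have key : ∀ c : Fq, (innerSeries (Fq := Fq) w i).toLinearMap (w j - c • w i) = 0 →
        (innerSeries (Fq := Fq) w (i + 1)).toLinearMap (w j) = 0 := by
      intro c hc
      rw [← norm_eq_zero, ← pow_eq_zero_iff (Fintype.card_ne_zero (α := Fq)),
        norm_innerSeries_succ_pow]
      exact Finset.prod_eq_zero (Finset.mem_univ c) (by rw [hc, norm_zero])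
    by_cases hji : j = i
    · subst hji
      exact key 1 (by simp)
    · exact key 0 (by simpa using ih (by omega))

theorem coeff_innerSeries_of_nonneg (w : ℕ → C) (i : ℕ) {n : ℤ} (hn : 0 ≤ n) :
    (innerSeries (Fq := Fq) w i).coeff n = if n = 0 then 1 else 0 := by
  induction i generalizing n with
  | zero =>
    change (Pi.single 0 1 : ℤ → C) n = _
    rw [Pi.single_apply]
  | succ i ih =>
    rw [innerSeries, coeff_sub, coeff_monomial_comp, ih hn, ih (by omega),
      if_neg (show n - -1 ≠ 0 by omega),
      map_zero, mul_zero, sub_zero]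

theorem gaussNorm_innerSeries_sub_le (w : ℕ → C) (i : ℕ) {R : ℝ} (hR : 0 ≤ R) :
    (innerSeries (Fq := Fq) w (i + 1) - innerSeries (Fq := Fq) w i).gaussNorm R ≤
      (‖(innerSeries (Fq := Fq) w i).toLinearMap (w i)‖ ^ (Fintype.card Fq - 1) *
        (innerSeries (Fq := Fq) w i).gaussNorm R) ^ ((Fintype.card Fq : ℝ)⁻¹) := by
  have h1 : (innerSeries (Fq := Fq) w (i + 1) - innerSeries (Fq := Fq) w i).gaussNorm R =
      ((monomial (Fq := Fq) ((frob Fq C ^ (-1 : ℤ)) ((innerSeries (Fq := Fq) w i).toLinearMap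
        (w i) ^ (Fintype.card Fq - 1))) (-1)).comp (innerSeries (Fq := Fq) w i)).gaussNorm R := by
    rw [gaussNorm_sub_comm, innerSeries]
    simp only [gaussNorm, termNorm, coeff_sub, sub_sub_cancel]
  rw [h1]
  refine (gaussNorm_monomial_comp_le _ _ _ hR).trans (le_of_eq ?_)
  rw [norm_frob_zpow_apply, norm_pow, zpow_neg_one,
    Real.mul_rpow (by positivity) (gaussNorm_nonneg _ hR)]

theorem gaussNorm_innerSeries_le {r : ℝ} (hr : 0 < r) {w : ℕ → C} (hw : ∀ i, ‖w i‖ ≤ r) (i : ℕ)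
    {R : ℝ} (hR : r ≤ R) : (innerSeries (Fq := Fq) w i).gaussNorm R ≤ R := by
  have hR0 := hr.trans_le hR
  induction i with
  | zero =>
    refine gaussNorm_le fun n => ?_
    change ‖(Pi.single 0 1 : ℤ → C) n‖ * _ ≤ R
    rcases eq_or_ne n 0 with rfl | hn
    · simp
    · rw [Pi.single_eq_of_ne hn, norm_zero, zero_mul]
      exact hR0.le
  | succ i ih =>
    refine (gaussNorm_le_max (innerSeries (Fq := Fq) w i) _ hR0.le).trans (max_le ?_ ih)
    refine (gaussNorm_innerSeries_sub_le w i hR0.le).trans ?_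
    have h1 := ((innerSeries (Fq := Fq) w i).norm_toLinearMap_le ((hw i).trans hR)).trans ih
    have h2 : ‖(innerSeries (Fq := Fq) w i).toLinearMap (w i)‖ ^ (Fintype.card Fq - 1) *
        (innerSeries (Fq := Fq) w i).gaussNorm R ≤ R ^ Fintype.card Fq := by
      rw [← Nat.sub_add_cancel (Fintype.card_pos (α := Fq)), pow_succ, Nat.add_sub_cancel]
      exact mul_le_mul (pow_le_pow_left₀ (norm_nonneg _) h1 _) ih (gaussNorm_nonneg _ hR0.le)
        (by positivity)
    refine (Real.rpow_le_rpow (mul_nonneg (by positivity) (gaussNorm_nonneg _ hR0.le)) h2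
      (by positivity)).trans (le_of_eq ?_)
    exact Real.pow_rpow_inv_natCast hR0.le Fintype.card_ne_zero

/-- A compact `𝔽_q`-subspace `H` of a disk with `∫_H v = +∞` is the kernel of a series, which may
be normalized so that `|f|_R = R` for `R` beyond the radius of the disk. -/
theorem exists_toLinearMap_eq_zero_iff_of_isCompact {H : AddSubgroup C}
    (hH : IsCompact (H : Set C)) (hsmul : ∀ (c : Fq), ∀ z ∈ H, c • z ∈ H) {r : ℝ} (hr0 : 0 < r)
    (hr : ∀ z ∈ H, ‖z‖ ≤ r) (hint : IntegralAddValEqTop H) :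
    ∃ f : FSeries Fq C, (∀ z, f.toLinearMap z = 0 ↔ z ∈ H) ∧ ∀ R, r ≤ R → f.gaussNorm R = R := by
  have : CompactSpace H := isCompact_iff_compactSpace.mp hH
  set w : ℕ → H := TopologicalSpace.denseSeq H with hwdef
  have hw : DenseRange w := TopologicalSpace.denseRange_denseSeq H
  set F : ℕ → FSeries Fq C := innerSeries fun n => (w n : C) with hF
  have hq : 1 < Fintype.card Fq := Fintype.one_lt_card
  have hle : ∀ i R, r ≤ R → (F i).gaussNorm R ≤ R := fun i R hR =>
    gaussNorm_innerSeries_le hr0 (fun n => hr _ (w n).2) i hR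
  have hval : Tendsto (fun i => ‖(F i).toLinearMap (w i)‖) atTop (𝓝 0) := by
    rw [Metric.tendsto_atTop]
    intro ε hε
    obtain ⟨ρ, hρ, N, hN⟩ := exists_avgLog_le hH hsmul hr hint hw (Real.log (ε / 2))
    refine ⟨N, fun i hi => ?_⟩
    rw [Real.dist_eq, sub_zero, abs_of_nonneg (norm_nonneg _)]
    refine (norm_innerSeries_le_exp_avgLog _ hρ i _).trans_lt ?_
    refine (Real.exp_le_exp.mpr (hN i hi _ (w i).2)).trans_lt ?_
    rw [Real.exp_log (half_pos hε)]
    exact half_lt_self hε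
  obtain ⟨g, hg⟩ := exists_limit F (by
    intro R hR
    set S := max R r with hS
    have hS0 : 0 < S := hR.trans_le (le_max_left _ _)
    have h1 : Tendsto (fun i => (‖(F i).toLinearMap (w i)‖ ^ (Fintype.card Fq - 1) * S) ^
        ((Fintype.card Fq : ℝ)⁻¹)) atTop (𝓝 0) := by
      have h2 := ((hval.pow (Fintype.card Fq - 1)).mul_const S).rpow_const
        (p := (Fintype.card Fq : ℝ)⁻¹) (Or.inr (by positivity))
      rwa [zero_pow (Nat.sub_pos_of_lt hq).ne', zero_mul, Real.zero_rpow (by positivity)] at h2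
    refine squeeze_zero (fun i => gaussNorm_nonneg _ hR.le) (fun i => ?_) h1
    refine ((F (i + 1) - F i).gaussNorm_mono hR.le (le_max_left R r)).trans ?_
    refine (gaussNorm_innerSeries_sub_le _ i hS0.le).trans ?_
    refine Real.rpow_le_rpow (mul_nonneg (by positivity) (gaussNorm_nonneg _ hS0.le)) ?_
      (by positivity)
    exact mul_le_mul_of_nonneg_left (hle i S (le_max_right _ _)) (by positivity))
  have hgz := tendsto_toLinearMap_of_gaussNorm hg
  refine ⟨g, fun z => ⟨fun hz => ?_, fun hz => ?_⟩, fun R hR => ?_⟩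
  · by_contra hzH
    obtain ⟨δ, hδ, hball⟩ := Metric.isOpen_iff.mp hH.isClosed.isOpen_compl z hzH
    have h1 : ∀ i, δ ≤ ‖(F i).toLinearMap z‖ := fun i =>
      le_norm_innerSeries hsmul (fun n => (w n).2) hδ.le i fun h hh => by
        by_contra! hlt
        rw [norm_sub_rev, ← dist_eq_norm] at hlt
        exact hball hlt hh
    have h2 := ge_of_tendsto' (hgz z).norm h1
    rw [hz, norm_zero] at h2
    linarith
  · have hcl : IsClosed {x : H | g.toLinearMap x = 0} :=
      isClosed_eq (g.continuous_toLinearMap.comp continuous_subtype_val) continuous_const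
    refine hw.induction_on (p := fun x : H => g.toLinearMap x = 0) ⟨z, hz⟩ hcl fun j => ?_
    refine tendsto_nhds_unique (hgz (w j)) (tendsto_nhds_of_eventually_eq ?_)
    filter_upwards [eventually_gt_atTop j] with i hi
    exact innerSeries_apply_eq_zero (fun n => (w n : C)) hi
  · have hR0 := hr0.trans_le hR
    apply le_antisymm
    · obtain ⟨i, hi⟩ := ((hg R hR0).eventually_le_const hR0).exists
      exact (gaussNorm_le_max (F i) g hR0.le).trans (max_le hi (hle i R hR))
    · have hc : g.coeff 0 = 1 := by
        have h1 : ‖g.coeff 0 - 1‖ * R ≤ 0 := by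
          refine ge_of_tendsto' (hg R hR0) fun i => ?_
          have h2 := (g - F i).termNorm_le_gaussNorm hR0.le 0
          rwa [termNorm, coeff_sub, hF, coeff_innerSeries_of_nonneg _ i le_rfl, if_pos rfl,
            zpow_zero, Real.rpow_one] at h2
        have h2 : ‖g.coeff 0 - 1‖ ≤ 0 := by
          by_contra! h
          exact absurd h1 (not_le.mpr (mul_pos h hR0))
        exact sub_eq_zero.mp (norm_le_zero_iff.mp h2)
      have h1 := g.termNorm_le_gaussNorm hR0.le 0
      rwa [termNorm, hc, norm_one, one_mul, zpow_zero, Real.rpow_one] at h1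

end FSeries

/-! ### Adjoining the discrete part of the kernel -/

/-- Only finitely many cosets of `G ∩ Δ_r` in `G` meet a given disk. -/
theorem IsClassG.finite_cosets {Fq C : Type*} [Field Fq] [NormedField C] [IsUltrametricDist C]
    [Algebra Fq C] {r : ℝ} {hr : 0 < r} {G : Submodule Fq C} (hG : IsClassG r hr G) (ρ : ℝ) :
    {Q : G.toAddSubgroup ⧸ (diskPart G r hr).addSubgroupOf G.toAddSubgroup |
      ∃ y : G.toAddSubgroup, ‖(y : C)‖ ≤ ρ ∧ QuotientAddGroup.mk y = Q}.Finite := by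
  have := hG.countable_index
  cases finite_or_infinite
    (G.toAddSubgroup ⧸ (diskPart G r hr).addSubgroupOf G.toAddSubgroup) with
  | inl h => exact Set.toFinite _
  | inr h =>
    obtain ⟨_⟩ := nonempty_denumerable
      (G.toAddSubgroup ⧸ (diskPart G r hr).addSubgroupOf G.toAddSubgroup)
    -- coset representatives chosen in the disk of radius `ρ` whenever possible
    have hrep : ∀ Q : G.toAddSubgroup ⧸ (diskPart G r hr).addSubgroupOf G.toAddSubgroup,
        ∃ y : G.toAddSubgroup, QuotientAddGroup.mk y = Q ∧
          ((∃ y : G.toAddSubgroup, ‖(y : C)‖ ≤ ρ ∧ QuotientAddGroup.mk y = Q) →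
            ‖(y : C)‖ ≤ ρ) := by
      intro Q
      by_cases hQ : ∃ y : G.toAddSubgroup, ‖(y : C)‖ ≤ ρ ∧ QuotientAddGroup.mk y = Q
      · obtain ⟨y, hy, hyQ⟩ := hQ
        exact ⟨y, hyQ, fun _ => hy⟩
      · obtain ⟨y, hy⟩ := QuotientAddGroup.mk_surjective Q
        exact ⟨y, hy, fun h => absurd h hQ⟩
    choose y hy hyρ using hrep
    set e := (Denumerable.eqv
      (G.toAddSubgroup ⧸ (diskPart G r hr).addSubgroupOf G.toAddSubgroup)).symm
    have hlim := hG.tendsto_coset_rep (fun n => y (e n)) (by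
      have h1 : (fun n => (QuotientAddGroup.mk (y (e n)) : G.toAddSubgroup ⧸
          (diskPart G r hr).addSubgroupOf G.toAddSubgroup)) = e := funext fun n => hy (e n)
      rw [h1]
      exact e.bijective)
    obtain ⟨N, hN⟩ := eventually_atTop.mp (hlim.eventually_gt_atTop ρ)
    refine ((Set.finite_lt_nat N).image e).subset fun Q hQ => ?_
    refine ⟨e.symm Q, ?_, e.apply_symm_apply Q⟩
    by_contra hlt
    have h1 := hN (e.symm Q) (not_lt.mp hlt)
    rw [Equiv.apply_symm_apply] at h1
    exact absurd (hyρ Q hQ) (not_le.mpr h1)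

/-- With `β = v^(1-q)`, and `β = 0` if `v = 0`, the `τ`-term of `1 - β τ` is small on elements that
are small compared with `v`. -/
theorem norm_inv_mul_pow_le (Fq : Type*) {C : Type*} [Field Fq] [Fintype Fq]
    [NormedField C] {v : C} {a ε : ℝ} (ha : 0 ≤ a) (hε0 : 0 ≤ ε) (hε1 : ε ≤ 1)
    (h : v = 0 ∨ a ≤ ε * ‖v‖) :
    ‖(v ^ (Fintype.card Fq - 1))⁻¹‖ * a ^ Fintype.card Fq ≤ ε * a := by
  have hq : 1 < Fintype.card Fq := Fintype.one_lt_card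
  rcases eq_or_ne v 0 with rfl | hv
  · rw [zero_pow (Nat.sub_pos_of_lt hq).ne', inv_zero, norm_zero, zero_mul]
    positivity
  · have hv' := norm_pos_iff.mpr hv
    have h1 := h.resolve_left hv
    have h2 : a ^ (Fintype.card Fq - 1) ≤ ε * ‖v‖ ^ (Fintype.card Fq - 1) := by
      refine (pow_le_pow_left₀ ha h1 _).trans ?_
      rw [mul_pow]
      refine mul_le_mul_of_nonneg_right ?_ (by positivity)
      exact pow_le_of_le_one hε0 hε1 (Nat.sub_pos_of_lt hq).ne'
    have h3 : a ^ Fintype.card Fq = a ^ (Fintype.card Fq - 1) * a := by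
      rw [← pow_succ, Nat.sub_add_cancel hq.le]
    rw [h3, norm_inv, norm_pow, ← mul_assoc]
    refine mul_le_mul_of_nonneg_right ?_ ha
    rw [inv_mul_le_iff₀ (by positivity), mul_comm]
    exact h2

namespace FSeries

variable {Fq C : Type*} [Field Fq] [Fintype Fq] [NormedField C] [IsAlgClosed C] [Algebra Fq C]
  [IsUltrametricDist C]

theorem gaussNorm_sub_monomial_comp {g : FSeries Fq C} (hg : g ≠ 0) (β : C) {R : ℝ} (hR : 0 < R) :
    (g - (monomial β 1).comp g).gaussNorm R =
      max (g.gaussNorm R) (‖β‖ * g.gaussNorm R ^ Fintype.card Fq) := by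
  have hcomp : ∀ n, ((monomial β 1).comp g).termNorm R n =
      ‖β‖ * g.termNorm R (n - 1) ^ Fintype.card Fq := fun n => by
    rw [termNorm_monomial_comp β 1 g hR.le, zpow_one, Real.rpow_natCast]
  have hcomple : ∀ n, ((monomial β 1).comp g).termNorm R n ≤
      ‖β‖ * g.gaussNorm R ^ Fintype.card Fq := fun n => by
    rw [hcomp]
    exact mul_le_mul_of_nonneg_left (pow_le_pow_left₀ (g.termNorm_nonneg hR.le _)
      (g.termNorm_le_gaussNorm hR.le _) _) (norm_nonneg _)
  have hsub : ∀ n, g.termNorm R n ≠ ((monomial β 1).comp g).termNorm R n →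
      (g - (monomial β 1).comp g).termNorm R n =
        max (g.termNorm R n) (((monomial β 1).comp g).termNorm R n) := by
    intro n hne
    unfold termNorm at hne ⊢
    rw [← max_mul_of_nonneg _ _ (by positivity), coeff_sub, sub_eq_add_neg,
      ← norm_neg (((monomial β 1).comp g).coeff n),
      IsUltrametricDist.norm_add_eq_max_of_norm_ne_norm]
    intro h
    rw [norm_neg] at h
    exact hne (by rw [h])
  apply le_antisymm
  · refine gaussNorm_le fun n => (termNorm_sub_le _ _ hR.le n).trans ?_
    exact max_le_max (g.termNorm_le_gaussNorm hR.le n) (hcomple n)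
  · obtain ⟨n, hn⟩ := exists_isTop hg hR
    have hgn := hn.gaussNorm_eq hR.le
    rcases le_or_gt (g.gaussNorm R) (‖β‖ * g.gaussNorm R ^ Fintype.card Fq) with h | h
    · have h1 : ((monomial β 1).comp g).termNorm R (n + 1) =
          ‖β‖ * g.gaussNorm R ^ Fintype.card Fq := by
        rw [hcomp, add_sub_cancel_right, hgn]
      have h2 : g.termNorm R (n + 1) < ((monomial β 1).comp g).termNorm R (n + 1) := by
        rw [h1]
        refine lt_of_lt_of_le ?_ h
        rw [hgn]
        exact hn.lt _ (lt_add_one n)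
      rw [max_eq_right h, ← h1]
      have h3 := hsub (n + 1) h2.ne
      rw [max_eq_right h2.le] at h3
      rw [← h3]
      exact termNorm_le_gaussNorm _ hR.le _
    · have h2 : ((monomial β 1).comp g).termNorm R n < g.termNorm R n := by
        refine (hcomple n).trans_lt ?_
        rwa [← hgn]
      rw [max_eq_left h.le, hgn]
      have h3 := hsub n h2.ne'
      rw [max_eq_left h2.le] at h3
      rw [← h3]
      exact termNorm_le_gaussNorm _ hR.le _

variable [CompleteSpace C]

/-- The series `g_i = (1 - β_{i-1} τ) ∘ ⋯ ∘ (1 - β_0 τ) ∘ g₀`, whose kernel is spanned by the kernel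
of `g₀` and `x 0, …, x (i - 1)`: the choice `β_i = g_i(x_i)^(1-q)` makes `g_{i+1}` vanish at `x i`.
If `g_i(x_i) = 0`, the convention `0⁻¹ = 0` gives `g_{i+1} = g_i`. -/
noncomputable def outerSeries (g₀ : FSeries Fq C) (x : ℕ → C) : ℕ → FSeries Fq C
  | 0 => g₀
  | i + 1 => outerSeries g₀ x i - (monomial
      (((outerSeries g₀ x i).toLinearMap (x i) ^ (Fintype.card Fq - 1))⁻¹) 1).comp
        (outerSeries g₀ x i)

variable (g₀ : FSeries Fq C) (x : ℕ → C)

theorem outerSeries_succ_apply (i : ℕ) (z : C) :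
    (outerSeries g₀ x (i + 1)).toLinearMap z = (outerSeries g₀ x i).toLinearMap z -
      ((outerSeries g₀ x i).toLinearMap (x i) ^ (Fintype.card Fq - 1))⁻¹ *
        (outerSeries g₀ x i).toLinearMap z ^ Fintype.card Fq := by
  rw [outerSeries, toLinearMap_sub, toLinearMap_monomial_comp, zpow_one, frob_apply]

theorem outerSeries_apply_mono {i j : ℕ} (hij : i ≤ j) {z : C}
    (hz : (outerSeries g₀ x i).toLinearMap z = 0) : (outerSeries g₀ x j).toLinearMap z = 0 := by
  induction j, hij using Nat.le_induction with
  | base => exact hz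
  | succ j _ ih => simp [outerSeries_succ_apply, ih]

theorem outerSeries_apply_eq_zero {i j : ℕ} (hij : i < j) :
    (outerSeries g₀ x j).toLinearMap (x i) = 0 := by
  refine outerSeries_apply_mono g₀ x (show i + 1 ≤ j from hij) ?_
  rw [outerSeries_succ_apply]
  rcases eq_or_ne ((outerSeries g₀ x i).toLinearMap (x i)) 0 with h | h
  · simp [h]
  · conv_lhs => rw [← Nat.sub_add_cancel (Fintype.card_pos (α := Fq)), pow_succ]
    rw [Nat.add_sub_cancel, inv_mul_cancel_left₀ (pow_ne_zero _ h), sub_self]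

theorem ker_outerSeries_le {G : Submodule Fq C} (hg : g₀.ker ≤ G) (hx : ∀ i, x i ∈ G) (i : ℕ) :
    (outerSeries g₀ x i).ker ≤ G := by
  induction i with
  | zero => exact hg
  | succ i ih =>
    intro z hz
    rw [mem_ker, outerSeries_succ_apply] at hz
    rcases eq_or_ne ((outerSeries g₀ x i).toLinearMap (x i)) 0 with h | h
    · rw [h, zero_pow (Nat.sub_pos_of_lt Fintype.one_lt_card).ne', inv_zero, zero_mul,
        sub_zero] at hz
      exact ih hz
    · have h1 : ∏ c : Fq, ((outerSeries g₀ x i).toLinearMap z -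
          c • (outerSeries g₀ x i).toLinearMap (x i)) = 0 := by
        rw [← pow_card_sub_mul_eq_prod]
        have h2 := pow_ne_zero (Fintype.card Fq - 1) h
        field_simp at hz
        linear_combination -hz
      obtain ⟨c, -, hc⟩ := Finset.prod_eq_zero_iff.mp h1
      have h2 : z - c • x i ∈ (outerSeries g₀ x i).ker := by
        rw [mem_ker, map_sub, map_smul, hc]
      have h3 := G.add_mem (ih h2) (G.smul_mem c (hx i))
      rwa [sub_add_cancel] at h3

theorem outerSeries_ne_zero (hg : g₀ ≠ 0) (i : ℕ) : outerSeries g₀ x i ≠ 0 := by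
  induction i with
  | zero => exact hg
  | succ i ih =>
    intro h
    have h1 := gaussNorm_sub_monomial_comp ih
      (((outerSeries g₀ x i).toLinearMap (x i) ^ (Fintype.card Fq - 1))⁻¹) one_pos
    rw [← outerSeries, h] at h1
    have h2 : (0 : FSeries Fq C).gaussNorm 1 ≤ 0 := gaussNorm_le fun n => by simp [termNorm]
    have h3 := gaussNorm_pos ih one_pos
    rw [h1] at h2
    exact absurd ((le_max_left _ _).trans h2) (not_le.mpr h3)

theorem gaussNorm_outerSeries_succ (hg : g₀ ≠ 0) (i : ℕ) {R : ℝ} (hR : 0 < R) :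
    (outerSeries g₀ x (i + 1)).gaussNorm R = max ((outerSeries g₀ x i).gaussNorm R)
      (‖((outerSeries g₀ x i).toLinearMap (x i) ^ (Fintype.card Fq - 1))⁻¹‖ *
        (outerSeries g₀ x i).gaussNorm R ^ Fintype.card Fq) := by
  rw [outerSeries, gaussNorm_sub_monomial_comp (outerSeries_ne_zero g₀ x hg i) _ hR]

theorem le_gaussNorm_outerSeries (hg : g₀ ≠ 0) (i : ℕ) {R : ℝ} (hR : 0 < R) :
    g₀.gaussNorm R ≤ (outerSeries g₀ x i).gaussNorm R := by
  induction i with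
  | zero => exact le_rfl
  | succ i ih =>
    rw [gaussNorm_outerSeries_succ g₀ x hg i hR]
    exact ih.trans (le_max_left _ _)

/-- Beyond the radius `r` the Gauss norms grow at least linearly. -/
theorem mul_gaussNorm_outerSeries_le (hg : g₀ ≠ 0) {r : ℝ} (hr : 0 < r)
    (hgR : ∀ R, r ≤ R → g₀.gaussNorm R = R) (i : ℕ) {R ρ : ℝ} (hR : r ≤ R) (hρ : R ≤ ρ) :
    ρ * (outerSeries g₀ x i).gaussNorm R ≤ R * (outerSeries g₀ x i).gaussNorm ρ := by
  have hR0 := hr.trans_le hR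
  have hρ0 := hR0.trans_le hρ
  induction i with
  | zero => rw [outerSeries, hgR R hR, hgR ρ (hR.trans hρ), mul_comm]
  | succ i ih =>
    rw [gaussNorm_outerSeries_succ g₀ x hg i hR0, gaussNorm_outerSeries_succ g₀ x hg i hρ0,
      mul_max_of_nonneg _ _ hρ0.le, mul_max_of_nonneg _ _ hR0.le]
    refine max_le_max ih ?_
    have h1 := gaussNorm_nonneg (outerSeries g₀ x i) hR0.le
    have h2 := (outerSeries g₀ x i).gaussNorm_mono hR0.le hρ
    rw [← Nat.sub_add_cancel (Fintype.card_pos (α := Fq)), pow_succ, pow_succ]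
    have h3 := pow_le_pow_left₀ h1 h2 (Fintype.card Fq - 1)
    have h4 := pow_nonneg (h1.trans h2) (Fintype.card Fq - 1)
    set β := ‖((outerSeries g₀ x i).toLinearMap (x i) ^ (Fintype.card Fq - 1 + 1 - 1))⁻¹‖
    calc ρ * (β * ((outerSeries g₀ x i).gaussNorm R ^ (Fintype.card Fq - 1) *
            (outerSeries g₀ x i).gaussNorm R))
        = β * ((outerSeries g₀ x i).gaussNorm R ^ (Fintype.card Fq - 1) *
            (ρ * (outerSeries g₀ x i).gaussNorm R)) := by ring
      _ ≤ β * ((outerSeries g₀ x i).gaussNorm ρ ^ (Fintype.card Fq - 1) *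
            (R * (outerSeries g₀ x i).gaussNorm ρ)) := by gcongr
      _ = _ := by ring

section ClassG

variable {r : ℝ} {hr : 0 < r} {G : Submodule Fq C}

/-- An index `i` violating the estimate gives `y` in the disk of radius `ρ` with
`y - x i ∈ ker g_i` but `y ∉ ker g_i`; such `y` lie in different cosets of `G ∩ Δ_r`. -/
theorem eventually_gaussNorm_lt_norm_outerSeries (hG : IsClassG r hr G)
    (hgH : ∀ z, g₀.toLinearMap z = 0 ↔ z ∈ diskPart G r hr) (hx : ∀ i, x i ∈ G) {ρ : ℝ}
    (hρ : 0 < ρ) : ∀ᶠ i in atTop, (outerSeries g₀ x i).toLinearMap (x i) = 0 ∨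
      (outerSeries g₀ x i).gaussNorm ρ < ‖(outerSeries g₀ x i).toLinearMap (x i)‖ := by
  have hgG : g₀.ker ≤ G := fun z hz => (mem_diskPart.mp ((hgH z).mp hz)).1
  rw [← Nat.cofinite_eq_atTop, eventually_cofinite]
  set S : Set ℕ := {i | ¬ ((outerSeries g₀ x i).toLinearMap (x i) = 0 ∨
      (outerSeries g₀ x i).gaussNorm ρ < ‖(outerSeries g₀ x i).toLinearMap (x i)‖)} with hS
  have hy : ∀ i : ℕ, ∃ y : G.toAddSubgroup, i ∈ S → ‖(y : C)‖ ≤ ρ ∧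
      (outerSeries g₀ x i).toLinearMap y = (outerSeries g₀ x i).toLinearMap (x i) := by
    intro i
    by_cases hi : i ∈ S
    · have hi' := hi
      rw [hS, Set.mem_ofPred_eq, not_or, not_lt] at hi'
      obtain ⟨y, hyρ, hyx⟩ := (outerSeries g₀ x i).exists_toLinearMap_eq hρ hi'.2
      have h1 : y - x i ∈ G := ker_outerSeries_le g₀ x hgG hx i (by
        rw [mem_ker, map_sub, hyx, sub_self])
      have h2 : y ∈ G := by simpa using G.add_mem h1 (hx i)
      exact ⟨⟨y, h2⟩, fun _ => ⟨hyρ, hyx⟩⟩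
    · exact ⟨0, fun h => absurd h hi⟩
  choose y hy using hy
  refine Set.Finite.of_injOn (f := fun i => (QuotientAddGroup.mk (y i) :
    G.toAddSubgroup ⧸ (diskPart G r hr).addSubgroupOf G.toAddSubgroup))
    ?_ ?_ (hG.finite_cosets ρ)
  · intro i hi
    exact ⟨y i, (hy i hi).1, rfl⟩
  have key : ∀ i ∈ S, ∀ j ∈ S, i < j → (QuotientAddGroup.mk (y i) :
      G.toAddSubgroup ⧸ (diskPart G r hr).addSubgroupOf G.toAddSubgroup) ≠
        QuotientAddGroup.mk (y j) := by
    intro i hi j hj hij h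
    rw [QuotientAddGroup.eq, AddSubgroup.mem_addSubgroupOf, ← hgH] at h
    have h1 := outerSeries_apply_mono g₀ x (Nat.zero_le j) h
    have h2 : (outerSeries g₀ x j).toLinearMap ((y i : C) - x i) = 0 :=
      outerSeries_apply_mono g₀ x hij.le (by rw [map_sub, (hy i hi).2, sub_self])
    rw [map_sub, outerSeries_apply_eq_zero g₀ x hij, sub_zero] at h2
    rw [AddSubgroup.coe_add, AddSubgroup.coe_neg, map_add, map_neg, h2, neg_zero, zero_add,
      (hy j hj).2] at h1
    exact hj (Or.inl h1)
  intro i hi j hj hij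
  rcases lt_trichotomy i j with h | h | h
  · exact absurd hij (key i hi j hj h)
  · exact h
  · exact absurd hij.symm (key j hj i hi h)

theorem exists_ker_eq (hG : IsClassG r hr G) : ∃ f : FSeries Fq C, f ≠ 0 ∧ f.ker = G := by
  obtain ⟨g₀, hgH, hgR⟩ := exists_toLinearMap_eq_zero_iff_of_isCompact (Fq := Fq) hG.isCompact
    (fun c z hz => by
      rw [mem_diskPart] at hz ⊢
      exact ⟨G.smul_mem c hz.1, (norm_finiteField_smul_le Fq c z).trans hz.2⟩)
    hr (fun z hz => (mem_diskPart.mp hz).2) hG.integral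
  have hg0 : g₀ ≠ 0 := by
    rintro rfl
    have h1 : (0 : FSeries Fq C).gaussNorm r ≤ 0 := gaussNorm_le fun n => by simp [termNorm]
    rw [hgR r le_rfl] at h1
    exact absurd hr (not_lt.mpr h1)
  have hgG : g₀.ker ≤ G := fun z hz => (mem_diskPart.mp ((hgH z).mp hz)).1
  have := hG.countable_index
  obtain ⟨Q, hQ⟩ := exists_surjective_nat
    (G.toAddSubgroup ⧸ (diskPart G r hr).addSubgroupOf G.toAddSubgroup)
  choose y hy using fun i => QuotientAddGroup.mk_surjective (Q i)
  set x : ℕ → C := fun i => (y i : C) with hxdef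
  have hx : ∀ i, x i ∈ G := fun i => (y i).2
  set F := outerSeries g₀ x with hF
  have hsmall : ∀ R, r ≤ R → ∀ ε : ℝ, 0 < ε → ε ≤ 1 → ∀ᶠ i in atTop,
      (F i).toLinearMap (x i) = 0 ∨ (F i).gaussNorm R ≤ ε * ‖(F i).toLinearMap (x i)‖ := by
    intro R hR ε hε hε1
    have hR0 := hr.trans_le hR
    filter_upwards [eventually_gaussNorm_lt_norm_outerSeries g₀ x hG hgH hx
      (div_pos hR0 hε)] with i hi
    refine hi.imp_right fun h => ?_
    have h1 := mul_gaussNorm_outerSeries_le g₀ x hg0 hr hgR i hR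
      ((le_div_iff₀ hε).mpr (mul_le_of_le_one_right hR0.le hε1))
    rw [div_mul_eq_mul_div, div_le_iff₀ hε, mul_assoc] at h1
    have h2 := le_of_mul_le_mul_left h1 hR0
    rw [mul_comm] at h2
    exact h2.trans (mul_le_mul_of_nonneg_left h.le hε.le)
  have hdiff : ∀ i R, 0 < R → (F (i + 1) - F i).gaussNorm R ≤
      ‖((F i).toLinearMap (x i) ^ (Fintype.card Fq - 1))⁻¹‖ *
        (F i).gaussNorm R ^ Fintype.card Fq := by
    intro i R hR
    have h1 : (F (i + 1) - F i).gaussNorm R = ((monomial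
        (((F i).toLinearMap (x i) ^ (Fintype.card Fq - 1))⁻¹) 1).comp (F i)).gaussNorm R := by
      rw [gaussNorm_sub_comm, hF, outerSeries]
      simp only [gaussNorm, termNorm, coeff_sub, sub_sub_cancel]
    rw [h1]
    refine (gaussNorm_monomial_comp_le _ _ _ hR.le).trans (le_of_eq ?_)
    rw [zpow_one, Real.rpow_natCast]
  obtain ⟨f, hf⟩ := exists_limit F (by
    intro R hR
    set S := max R r with hSdef
    have hS0 : 0 < S := hR.trans_le (le_max_left _ _)
    have hstep : ∀ ε : ℝ, 0 < ε → ε ≤ 1 → ∀ᶠ i in atTop,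
        (F (i + 1) - F i).gaussNorm S ≤ ε * (F i).gaussNorm S := by
      intro ε hε hε1
      filter_upwards [hsmall S (le_max_right _ _) ε hε hε1] with i hi
      exact (hdiff i S hS0).trans
        (norm_inv_mul_pow_le Fq (gaussNorm_nonneg _ hS0.le) hε.le hε1 hi)
    obtain ⟨N, hN⟩ := eventually_atTop.mp (hstep 1 one_pos le_rfl)
    have hbound : ∀ i ≥ N, (F i).gaussNorm S ≤ (F N).gaussNorm S := by
      intro i hi
      induction i, hi using Nat.le_induction with
      | base => exact le_rfl
      | succ i hi ih =>
        refine (gaussNorm_le_max (F i) _ hS0.le).trans (max_le ?_ ih)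
        have := hN i hi
        rw [one_mul] at this
        exact this.trans ih
    set M := (F N).gaussNorm S with hM
    have hM0 : 0 ≤ M := gaussNorm_nonneg _ hS0.le
    rw [Metric.tendsto_nhds]
    intro ε hε
    have hε' : 0 < min 1 (ε / (2 * (M + 1))) := by positivity
    filter_upwards [hstep _ hε' (min_le_left _ _), eventually_ge_atTop N] with i hi hiN
    rw [Real.dist_eq, sub_zero, abs_of_nonneg (gaussNorm_nonneg _ hR.le)]
    calc (F (i + 1) - F i).gaussNorm R ≤ (F (i + 1) - F i).gaussNorm S :=
          gaussNorm_mono _ hR.le (le_max_left _ _)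
      _ ≤ _ := hi
      _ ≤ ε / (2 * (M + 1)) * (M + 1) := by
          refine mul_le_mul (min_le_right _ _) ((hbound i hiN).trans (by linarith))
            (gaussNorm_nonneg _ hS0.le) (by positivity)
      _ = ε / 2 := by field_simp
      _ < ε := half_lt_self hε)
  have hfz := tendsto_toLinearMap_of_gaussNorm hf
  refine ⟨f, ?_, ?_⟩
  · rintro rfl
    have h1 : r ≤ 0 := by
      refine ge_of_tendsto' (hf r hr) fun i => ?_
      have h2 := le_gaussNorm_outerSeries g₀ x hg0 i hr
      rw [hgR r le_rfl] at h2
      refine h2.trans (le_of_eq ?_)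
      simp only [gaussNorm, termNorm, coeff_sub, coeff_zero, zero_sub, norm_neg, hF]
    exact absurd hr (not_lt.mpr h1)
  · ext z
    rw [mem_ker]
    constructor
    · intro hz
      by_contra hzG
      have hev := hsmall (max ‖z‖ r) (le_max_right _ _) (1 / 2) (by norm_num) (by norm_num)
      obtain ⟨N, hN⟩ := eventually_atTop.mp hev
      have hne : ∀ i, (F i).toLinearMap z ≠ 0 := fun i h =>
        hzG (ker_outerSeries_le g₀ x hgG hx i h)
      have hstable : ∀ i ≥ N, ‖(F N).toLinearMap z‖ ≤ ‖(F i).toLinearMap z‖ := by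
        intro i hi
        induction i, hi using Nat.le_induction with
        | base => exact le_rfl
        | succ i hi ih =>
          refine ih.trans ?_
          have h1 : ‖((F i).toLinearMap (x i) ^ (Fintype.card Fq - 1))⁻¹ *
              (F i).toLinearMap z ^ Fintype.card Fq‖ ≤ 1 / 2 * ‖(F i).toLinearMap z‖ := by
            rw [norm_mul, norm_pow]
            exact norm_inv_mul_pow_le Fq (norm_nonneg _) (by norm_num) (by norm_num)
              ((hN i hi).imp_right ((norm_toLinearMap_le _ (le_max_left _ _)).trans ·))
          have h2 := IsUltrametricDist.norm_add_le_max ((F (i + 1)).toLinearMap z)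
            (((F i).toLinearMap (x i) ^ (Fintype.card Fq - 1))⁻¹ *
              (F i).toLinearMap z ^ Fintype.card Fq)
          have h3 := norm_pos_iff.mpr (hne i)
          rw [hF, outerSeries_succ_apply, sub_add_cancel, ← hF] at h2
          rw [hF, outerSeries_succ_apply, ← hF]
          rcases le_max_iff.mp h2 with h | h
          · exact h
          · linarith
      have h1 : ‖(F N).toLinearMap z‖ ≤ ‖f.toLinearMap z‖ :=
        ge_of_tendsto (hfz z).norm ((eventually_ge_atTop N).mono hstable)
      rw [hz, norm_zero] at h1
      exact hne N (norm_le_zero_iff.mp h1)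
    · intro hz
      obtain ⟨i, hi⟩ := hQ (QuotientAddGroup.mk (⟨z, hz⟩ : G.toAddSubgroup))
      rw [← hy i, QuotientAddGroup.eq, AddSubgroup.mem_addSubgroupOf, ← hgH] at hi
      refine tendsto_nhds_unique (hfz z) (tendsto_nhds_of_eventually_eq ?_)
      filter_upwards [eventually_gt_atTop i] with j hj
      have h1 := outerSeries_apply_mono g₀ x (Nat.zero_le j) hi
      rw [AddSubgroup.coe_add, AddSubgroup.coe_neg, map_add, map_neg,
        outerSeries_apply_eq_zero g₀ x hj, neg_zero, zero_add] at h1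
      exact h1

end ClassG

end FSeries

theorem mainTheorem5 {Fq C : Type*} [Field Fq] [Fintype Fq]
    [NormedField C] [IsUltrametricDist C] [CompleteSpace C] [IsAlgClosed C] [Algebra Fq C]
    (r : ℝ) (hr : 0 < r) (G : Submodule Fq C) (hG : IsClassG r hr G) :
    (∃ f : FSeries Fq C, f.ker = G) ∧
      ∀ f g : FSeries Fq C, f.ker = G → g.ker = G →
        (∃ (ε : C) (n : ℤ), ε ≠ 0 ∧ g = (FSeries.monomial ε n).comp f) ∧
        (∃ u : FSeries Fq C, u.IsUnit ∧ g = u.comp f) := by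
  obtain ⟨f₀, hf₀, hker⟩ := FSeries.exists_ker_eq hG
  refine ⟨⟨f₀, hker⟩, fun f g hf hg => ?_⟩
  have hne : ∀ f : FSeries Fq C, f.ker = G → f ≠ 0 := by
    rintro f hf rfl
    refine FSeries.ker_ne_top hf₀ (hker.trans (hf.symm.trans (eq_top_iff.mpr fun z _ => ?_)))
    rw [FSeries.mem_ker, FSeries.toLinearMap_apply]
    simp
  obtain ⟨ε, n, hε, h⟩ := FSeries.exists_eq_monomial_comp (hne f hf) (hne g hg) (hf.trans hg.symm)
  exact ⟨⟨ε, n, hε, h⟩, ⟨_, FSeries.isUnit_monomial hε n, h⟩⟩
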